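/- Let $n>3$, let $T\subseteq\mathbb R$ be an open interval, let $(M^*,g^*)$ be a smooth Riemannian manifold of dimension $n-1$, and let $a:T\to(0,\infty)$ be smooth. Consider the generalized Robertson-Walker (GRW) space-time $M=T\times M^*$ with the Lorentzian metric $g=-dt^2+a(t)^2g^*$ and the unit time-like field $u=\partial_t$. Write $R_{kl}$ for its Ricci tensor, $R=R^k{}_k$ for its scalar curvature, $\nabla$ for its Levi-Civita connection, and $\dot f=u^k\nabla_kf$. Then $u$ is an eigenvector of the Ricci tensor, $R_{kl}u^l=\xi u_k$ with $\xi=-R_{kl}u^ku^l$. Consider the following conditions. (CK) The Ricci tensor is a conformal Killing tensor, i.e. $\nabla R_{kl}$ lies in Gray's subspace $\mathcal I\oplus\mathcal A$: $$\nabla_jR_{kl}+\nabla_kR_{jl}+\nabla_lR_{kj}=\tfrac{2}{n+2}\left(g_{kl}\nabla_jR+g_{jl}\nabla_kR+g_{kj}\nabla_lR\right).$$ (I) $\nabla_jR_{kl}$ lies in Gray's subspace $\mathcal I$: $$\nabla_jR_{kl}=a_jg_{kl}+b_kg_{jl}+b_lg_{jk},\qquad a_j=\tfrac{n}{(n-1)(n+2)}\nabla_jR,\quad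 b_j=\tfrac{n-2}{2(n-1)(n+2)}\nabla_jR.$$ (PF) The Ricci tensor has the perfect-fluid form $R_{kl}=A\,g_{kl}+B\,v_kv_l$ with smooth scalar fields $A,B$ and a smooth vector field $v$ with $v^kv_k=-1$; and $(n+2)\dot\xi=2\dot R$. Theorem. If the warping function $a$ is not constant, then (CK) holds if and only if (PF) holds, and (CK) holds if and only if (I) holds; in particular the subspaces $\mathcal I\oplus\mathcal A$ and $\mathcal I$ coincide for GRW space-times with non-constant warping function. Moreover (PF) implies (I) and (CK) also when $a$ is constant. -/

import Mathlib

open scoped Manifold ContDiff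

noncomputable section

namespace GRW

/-! ### Tensor calculus in coordinates

`E` is the coordinate space with coordinate basis `b`; a tensor field is given by its component
functions on `E`. The argument `g` is the family of components `g i j` of the metric tensor. -/

section Coordinates

variable {ι E : Type*} [Fintype ι] [DecidableEq ι] [NormedAddCommGroup E] [NormedSpace ℝ E]

/-- The partial derivative `∂_i f`. -/
def pd (b : Module.Basis ι ℝ E) (i : ι) (f : E → ℝ) (x : E) : ℝ :=
  fderiv ℝ f x (b i)

/-- The components `g^{ij}` of the inverse metric. -/
def invMetric (g : ι → ι → E → ℝ) (i j : ι) (x : E) : ℝ :=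
  (Matrix.of fun k l => g k l x)⁻¹ i j

/-- The Christoffel symbols `Γ^k_{ij} = ½ g^{kl} (∂_i g_{jl} + ∂_j g_{il} - ∂_l g_{ij})` of the
Levi-Civita connection. -/
def christoffel (b : Module.Basis ι ℝ E) (g : ι → ι → E → ℝ) (k i j : ι) (x : E) : ℝ :=
  1 / 2 * ∑ l, invMetric g k l x * (pd b i (g j l) x + pd b j (g i l) x - pd b l (g i j) x)

/-- The Riemann tensor
`R^k_{lij} = ∂_i Γ^k_{jl} - ∂_j Γ^k_{il} + Γ^k_{im} Γ^m_{jl} - Γ^k_{jm} Γ^m_{il}`. -/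
def riemann (b : Module.Basis ι ℝ E) (g : ι → ι → E → ℝ) (k l i j : ι) (x : E) : ℝ :=
  pd b i (christoffel b g k j l) x - pd b j (christoffel b g k i l) x
    + ∑ m, (christoffel b g k i m x * christoffel b g m j l x
      - christoffel b g k j m x * christoffel b g m i l x)

/-- The Ricci tensor `R_{kl} = R^m_{kml}`. -/
def ricci (b : Module.Basis ι ℝ E) (g : ι → ι → E → ℝ) (k l : ι) (x : E) : ℝ :=
  ∑ m, riemann b g m k m l x

/-- The scalar curvature `R = g^{kl} R_{kl}`. -/
def scalarCurv (b : Module.Basis ι ℝ E) (g : ι → ι → E → ℝ) (x : E) : ℝ :=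
  ∑ k, ∑ l, invMetric g k l x * ricci b g k l x

/-- The gradient of the Ricci tensor,
`∇_j R_{kl} = ∂_j R_{kl} - Γ^m_{jk} R_{ml} - Γ^m_{jl} R_{km}`. -/
def nablaRicci (b : Module.Basis ι ℝ E) (g : ι → ι → E → ℝ) (j k l : ι) (x : E) : ℝ :=
  pd b j (ricci b g k l) x
    - ∑ m, christoffel b g m j k x * ricci b g m l x
    - ∑ m, christoffel b g m j l x * ricci b g k m x

/-- Lowering an index: `v_k = g_{kl} v^l`. -/
def lower (g : ι → ι → E → ℝ) (v : ι → E → ℝ) (k : ι) (x : E) : ℝ :=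
  ∑ l, g k l x * v l x

/-- The directional derivative `v^k ∂_k f` of a scalar; it is `ḟ` when `v` is the velocity field. -/
def dirDeriv (b : Module.Basis ι ℝ E) (v : ι → E → ℝ) (f : E → ℝ) (x : E) : ℝ :=
  ∑ k, v k x * pd b k f x

/-- The function `-R_{kl} u^k u^l`. If `u` is a unit time-like eigenvector of the Ricci tensor,
`R_{kl} u^l = ξ u_k` and `u_k u^k = -1`, this is the eigenvalue `ξ`. -/
def eigenvalue (b : Module.Basis ι ℝ E) (g : ι → ι → E → ℝ) (u : ι → E → ℝ) (x : E) : ℝ :=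
  -∑ k, ∑ l, ricci b g k l x * u k x * u l x

end Coordinates

/-! ### Tensor equations on a manifold

`M` is a manifold (without boundary) modelled on `E` through `I`, with metric tensor `g`. A tensor
equation holds on `M` if its components hold at every point of every chart of the atlas. -/

section Manifold

variable {ι E H M : Type*} [Fintype ι] [DecidableEq ι] [NormedAddCommGroup E] [NormedSpace ℝ E]
  [TopologicalSpace H] [TopologicalSpace M] [ChartedSpace H M]

/-- The coordinate vector field `∂_i` of the chart `e`, at the point with coordinates `x`. -/
def coordVector (I : ModelWithCorners ℝ E H) (b : Module.Basis ι ℝ E)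
    (e : OpenPartialHomeomorph M H) (i : ι) (x : E) : TangentSpace I ((e.extend I).symm x) :=
  mfderiv 𝓘(ℝ, E) I (e.extend I).symm x (b i)

/-- The components `g_{ij} = g(∂_i, ∂_j)` of the metric tensor in the chart `e`. -/
def metricComp (I : ModelWithCorners ℝ E H) (b : Module.Basis ι ℝ E)
    (g : ∀ p : M, LinearMap.BilinForm ℝ (TangentSpace I p))
    (e : OpenPartialHomeomorph M H) (i j : ι) (x : E) : ℝ :=
  g ((e.extend I).symm x) (coordVector I b e i x) (coordVector I b e j x)

/-- The components `v^i` of a vector field in the chart `e`. -/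
def vectorComp (I : ModelWithCorners ℝ E H) (b : Module.Basis ι ℝ E)
    (v : ∀ p : M, TangentSpace I p) (e : OpenPartialHomeomorph M H) (i : ι) (x : E) : ℝ :=
  b.repr (mfderiv I 𝓘(ℝ, E) (e.extend I) ((e.extend I).symm x) (v ((e.extend I).symm x))) i

/-- The Ricci tensor is a conformal Killing tensor (it lies in Gray's subspace `𝓘 ⊕ 𝓐`):
`∇_j R_{kl} + ∇_k R_{jl} + ∇_l R_{kj}
  = 2/(n+2) (∇_j R g_{kl} + ∇_k R g_{jl} + ∇_l R g_{kj})`. -/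
def RicciConformalKilling (I : ModelWithCorners ℝ E H) (b : Module.Basis ι ℝ E)
    (g : ∀ p : M, LinearMap.BilinForm ℝ (TangentSpace I p)) : Prop :=
  ∀ e ∈ atlas H M, ∀ x ∈ (e.extend I).target, ∀ j k l : ι,
    let G := metricComp I b g e
    let n : ℝ := Fintype.card ι
    nablaRicci b G j k l x + nablaRicci b G k j l x + nablaRicci b G l k j x
      = 2 * pd b j (scalarCurv b G) x / (n + 2) * G k l x
        + 2 * pd b k (scalarCurv b G) x / (n + 2) * G j l x
        + 2 * pd b l (scalarCurv b G) x / (n + 2) * G k j x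

/-- The gradient of the Ricci tensor lies in Gray's subspace `𝓘` (the trace-free part of `∇_j R_{kl}`
vanishes): `∇_j R_{kl} = a_j g_{kl} + b_k g_{jl} + b_l g_{jk}` with
`a_j = n / ((n-1)(n+2)) ∇_j R` and `b_j = (n-2) / (2(n-1)(n+2)) ∇_j R`. -/
def RicciSinyukov (I : ModelWithCorners ℝ E H) (b : Module.Basis ι ℝ E)
    (g : ∀ p : M, LinearMap.BilinForm ℝ (TangentSpace I p)) : Prop :=
  ∀ e ∈ atlas H M, ∀ x ∈ (e.extend I).target, ∀ j k l : ι,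
    let G := metricComp I b g e
    let n : ℝ := Fintype.card ι
    let α : ι → ℝ := fun i => n / ((n - 1) * (n + 2)) * pd b i (scalarCurv b G) x
    let β : ι → ℝ := fun i => (n - 2) / (2 * (n - 1) * (n + 2)) * pd b i (scalarCurv b G) x
    nablaRicci b G j k l x = α j * G k l x + β k * G j l x + β l * G j k x

/-- The Ricci tensor has the perfect-fluid form `R_{kl} = A g_{kl} + B v_k v_l`, where `A`, `B` are
smooth scalar fields and `v` is a smooth unit time-like vector field. -/
def RicciPerfectFluid (I : ModelWithCorners ℝ E H) [IsManifold I 1 M] (b : Module.Basis ι ℝ E)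
    (g : ∀ p : M, LinearMap.BilinForm ℝ (TangentSpace I p)) : Prop :=
  ∃ (A B : M → ℝ) (v : ∀ p : M, TangentSpace I p),
    ContMDiff I 𝓘(ℝ, ℝ) ∞ A ∧ ContMDiff I 𝓘(ℝ, ℝ) ∞ B ∧
    ContMDiff I I.tangent ∞ (fun p => (⟨p, v p⟩ : TangentBundle I M)) ∧
    (∀ p, g p (v p) (v p) = -1) ∧
    ∀ e ∈ atlas H M, ∀ x ∈ (e.extend I).target, ∀ k l : ι,
      let G := metricComp I b g e
      let w := lower G (vectorComp I b v e)
      ricci b G k l x = A ((e.extend I).symm x) * G k l x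
        + B ((e.extend I).symm x) * w k x * w l x

/-- The vector field `u` is an eigenvector of the Ricci tensor, `R_{kl} u^l = ξ u_k`, with
`ξ = -R_{kl} u^k u^l`. -/
def RicciEigenvector (I : ModelWithCorners ℝ E H) (b : Module.Basis ι ℝ E)
    (g : ∀ p : M, LinearMap.BilinForm ℝ (TangentSpace I p))
    (u : ∀ p : M, TangentSpace I p) : Prop :=
  ∀ e ∈ atlas H M, ∀ x ∈ (e.extend I).target, ∀ k : ι,
    let G := metricComp I b g e
    let U := vectorComp I b u e
    ∑ l, ricci b G k l x * U l x = eigenvalue b G U x * lower G U k x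

/-- The equation `(n + 2) ξ̇ = 2 Ṙ`, where the dot is the derivative along `u`. -/
def EigenvalueEquation (I : ModelWithCorners ℝ E H) (b : Module.Basis ι ℝ E)
    (g : ∀ p : M, LinearMap.BilinForm ℝ (TangentSpace I p))
    (u : ∀ p : M, TangentSpace I p) : Prop :=
  ∀ e ∈ atlas H M, ∀ x ∈ (e.extend I).target,
    let G := metricComp I b g e
    let U := vectorComp I b u e
    ((Fintype.card ι : ℝ) + 2) * dirDeriv b U (eigenvalue b G U) x
      = 2 * dirDeriv b U (scalarCurv b G) x

end Manifold

/-! ### Generalized Robertson-Walker space-times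

The time axis is an open interval `T` of the real line; as the chart of `T` is the inclusion in `ℝ`,
the tangent space of `T × N` at a point is `ℝ × ℝ^d`, the first factor being the `dt`-component. -/

section Warped

variable {d : ℕ} {N : Type*} [TopologicalSpace N] [ChartedSpace (EuclideanSpace ℝ (Fin d)) N]
  [IsManifold 𝓘(ℝ, EuclideanSpace ℝ (Fin d)) ∞ N]

/-- The model of the product of a time interval with a `d`-dimensional manifold. -/
abbrev model (d : ℕ) :
    ModelWithCorners ℝ (ℝ × EuclideanSpace ℝ (Fin d)) (ModelProd ℝ (EuclideanSpace ℝ (Fin d))) :=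
  𝓘(ℝ, ℝ).prod 𝓘(ℝ, EuclideanSpace ℝ (Fin d))

/-- The standard basis of `ℝ × ℝ^d`; it has `n = d + 1` elements. -/
def stdBasis (d : ℕ) : Module.Basis (Unit ⊕ Fin d) ℝ (ℝ × EuclideanSpace ℝ (Fin d)) :=
  (Module.Basis.singleton Unit ℝ).prod (EuclideanSpace.basisFun (Fin d) ℝ).toBasis

/-- The metric `-dt² + a(t)² g*` of the warped product `-T ×_a N`, where `h = g*`. -/
def warpedMetric (T : TopologicalSpace.Opens ℝ) (a : ℝ → ℝ)
    (h : Bundle.ContMDiffRiemannianMetric 𝓘(ℝ, EuclideanSpace ℝ (Fin d)) ∞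
      (EuclideanSpace ℝ (Fin d))
      (fun y : N => TangentSpace 𝓘(ℝ, EuclideanSpace ℝ (Fin d)) y))
    (p : T × N) : LinearMap.BilinForm ℝ (TangentSpace (model d) p) :=
  let dt : TangentSpace (model d) p →ₗ[ℝ] ℝ :=
    LinearMap.fst ℝ ℝ (EuclideanSpace ℝ (Fin d))
  let pr : TangentSpace (model d) p →ₗ[ℝ] TangentSpace 𝓘(ℝ, EuclideanSpace ℝ (Fin d)) p.2 :=
    LinearMap.snd ℝ ℝ (EuclideanSpace ℝ (Fin d))
  (a p.1) ^ 2 • (h.inner p.2).toBilinForm.compl₁₂ pr pr - (LinearMap.mul ℝ ℝ).compl₁₂ dt dt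

theorem warpedMetric_apply (T : TopologicalSpace.Opens ℝ) (a : ℝ → ℝ)
    (h : Bundle.ContMDiffRiemannianMetric 𝓘(ℝ, EuclideanSpace ℝ (Fin d)) ∞
      (EuclideanSpace ℝ (Fin d))
      (fun y : N => TangentSpace 𝓘(ℝ, EuclideanSpace ℝ (Fin d)) y))
    (p : T × N) (v w : ℝ × EuclideanSpace ℝ (Fin d)) :
    warpedMetric T a h p v w = (a p.1) ^ 2 * h.inner p.2 v.2 w.2 - v.1 * w.1 :=
  rfl

/-- The vector field `∂_t`. -/
def timeVector (T : TopologicalSpace.Opens ℝ) (p : T × N) : TangentSpace (model d) p :=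
  ((1, 0) : ℝ × EuclideanSpace ℝ (Fin d))

end Warped

end GRW

end

noncomputable section

set_option linter.unusedSectionVars false

namespace GRW

/-! ### Partial derivatives on an open set. -/

section Calculus

variable {ι E : Type*} [NormedAddCommGroup E] [NormedSpace ℝ E]
  {b : Module.Basis ι ℝ E} {V : Set E} {x : E}

/-! Write d = n - 1, H = ȧ/a, ξ = d ä/a, F = (d-1)ȧ² + a ä, and let R* and s be the Ricci tensor and
the scalar curvature of the fibre. In a product chart the Ricci tensor is block diagonal, R_tt = -ξ
and R_ij = R*_ij + F g*_ij. The only components of its gradient that need not vanish are ∇_t R_tt =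
-ξ̇, ∇_t R_ij = Ḟ g*_ij - 2H(R*_ij + F g*_ij), ∇_i R_tj = ∇_i R_jt = aȧξ g*_ij - H(R*_ij + F g*_ij)
and ∇_l R_ij = ∇*_l R*_ij. The whole question is whether the fibre is Einstein.

(CK) implies (PF). The ttt-component of (CK) is the equation for ξ̇. The tij-component then equates
4H R*_ij with a multiple of g*_ij whose factor depends on t alone
(`IsWarped.ricci_of_conformalKilling`). A non-constant a on an interval has H ≠ 0 at some t₀, so R*
is a constant multiple of g*, the constant being read off from a at t₀. This direction needs neither
Schur's lemma nor a connected fibre, and ∂_t serves as the fluid velocity.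

(PF) implies (I). A unit time-like v has non-zero time component, so R_ti = 0 kills the spatial part
of B v and the fibre is Einstein (`IsWarped.ricci_of_perfectFluid`). As d ≥ 3, `schur` makes s
locally constant, hence ∇*R* = 0 and the spatial derivatives of R = ξ + (dF + s)/a² vanish. The
surviving components of the gradient are multiples of g, and the equation for ξ̇ forces the
multiples prescribed by (I) (`warped_identities`, `IsWarped.nablaRicci_of_einstein`). No assumption
on ȧ enters.

(I) implies (CK) by symmetrisation (`conformalKilling_of_sinyukov`).

All this is done for component functions satisfying `IsWarped`; `isWarped_productChart` shows that
every chart of the product provides such functions. -/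

theorem pd_congr (hV : IsOpen V) (hx : x ∈ V) {f f' : E → ℝ} (hf : Set.EqOn f f' V) (i : ι) :
    pd b i f x = pd b i f' x := by
  unfold pd
  rw [(hf.eventuallyEq_of_mem (hV.mem_nhds hx)).fderiv_eq]

theorem pd_const (c : ℝ) (i : ι) : pd b i (fun _ => c) x = 0 := by
  simp [pd]

theorem pd_add {f f' : E → ℝ} (hf : DifferentiableAt ℝ f x) (hf' : DifferentiableAt ℝ f' x)
    (i : ι) : pd b i (fun y => f y + f' y) x = pd b i f x + pd b i f' x := by
  simp [pd, fderiv_fun_add hf hf']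

theorem pd_sub {f f' : E → ℝ} (hf : DifferentiableAt ℝ f x) (hf' : DifferentiableAt ℝ f' x)
    (i : ι) : pd b i (fun y => f y - f' y) x = pd b i f x - pd b i f' x := by
  simp [pd, fderiv_fun_sub hf hf']

theorem pd_mul {f f' : E → ℝ} (hf : DifferentiableAt ℝ f x) (hf' : DifferentiableAt ℝ f' x)
    (i : ι) : pd b i (fun y => f y * f' y) x = pd b i f x * f' x + f x * pd b i f' x := by
  simp [pd, fderiv_fun_mul hf hf']
  ring

theorem pd_sum {κ : Type*} (s : Finset κ) {f : κ → E → ℝ}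
    (hf : ∀ k, DifferentiableAt ℝ (f k) x) (i : ι) :
    pd b i (fun y => ∑ k ∈ s, f k y) x = ∑ k ∈ s, pd b i (f k) x := by
  simp [pd, fderiv_fun_sum (fun k _ => hf k)]

theorem contDiffOn_pd (hV : IsOpen V) {f : E → ℝ} (hf : ContDiffOn ℝ ∞ f V) (i : ι) :
    ContDiffOn ℝ ∞ (pd b i f) V :=
  (hf.fderiv_of_isOpen hV (m := ∞) le_rfl).clm_apply contDiffOn_const

theorem ContDiffOn.differentiableAt_of_isOpen (hV : IsOpen V) (hx : x ∈ V) {f : E → ℝ}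
    (hf : ContDiffOn ℝ ∞ f V) : DifferentiableAt ℝ f x :=
  (hf.contDiffAt (hV.mem_nhds hx)).differentiableAt (by simp)

theorem pd_comm (hV : IsOpen V) (hx : x ∈ V) {f : E → ℝ} (hf : ContDiffOn ℝ ∞ f V) (i j : ι) :
    pd b i (pd b j f) x = pd b j (pd b i f) x := by
  have hf' : DifferentiableAt ℝ (fderiv ℝ f) x :=
    ((hf.fderiv_of_isOpen hV (m := ∞) le_rfl).contDiffAt (hV.mem_nhds hx)).differentiableAt (by simp)
  have h : ∀ i j, pd b i (pd b j f) x = fderiv ℝ (fderiv ℝ f) x (b i) (b j) := by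
    intro i j
    unfold pd
    rw [fderiv_clm_apply hf' (differentiableAt_const _)]
    simp
  rw [h, h]
  exact (hf.contDiffAt (hV.mem_nhds hx)).isSymmSndFDerivAt
    (by simpa [minSmoothness] using (WithTop.coe_le_coe.2 le_top : ((2 : ℕ∞) : WithTop ℕ∞) ≤ ∞))
    (b i) (b j)

end Calculus

/-! ### Smoothness of the curvature components. -/

section Smoothness

variable {ι E : Type*} [Fintype ι] [DecidableEq ι] [NormedAddCommGroup E] [NormedSpace ℝ E]
  {b : Module.Basis ι ℝ E} {V : Set E} {g : ι → ι → E → ℝ}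

theorem contDiffOn_det {κ : Type*} [Fintype κ] [DecidableEq κ] {m : κ → κ → E → ℝ}
    (hm : ∀ i j, ContDiffOn ℝ ∞ (m i j) V) :
    ContDiffOn ℝ ∞ (fun x => (Matrix.of fun i j => m i j x).det) V := by
  simp only [Matrix.det_apply, Matrix.of_apply]
  exact ContDiffOn.sum fun σ _ => (contDiffOn_prod fun i _ => hm _ _).const_smul _

theorem contDiffOn_invMetric (hg : ∀ i j, ContDiffOn ℝ ∞ (g i j) V)
    (hdet : ∀ x ∈ V, (Matrix.of fun i j => g i j x).det ≠ 0) (i j : ι) :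
    ContDiffOn ℝ ∞ (invMetric g i j) V := by
  -- Cramer's rule: an entry of the adjugate is the determinant of the matrix with row j replaced by
  -- a unit vector, so smoothness reduces to that of determinants.
  have h : invMetric g i j = fun x => ((Matrix.of fun i j => g i j x).det)⁻¹ *
      (Matrix.of fun k l => Function.update (fun k l => g k l x) j (Pi.single i 1) k l).det := by
    funext x
    simp only [invMetric, Matrix.inv_def, Matrix.smul_apply, Matrix.adjugate_apply, smul_eq_mul,
      Ring.inverse_eq_inv']
    rfl
  rw [h]
  refine ((contDiffOn_det hg).inv hdet).mul ?_
  refine contDiffOn_det (m := fun k l x => Function.update (fun k l => g k l x) j (Pi.single i 1) k l)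
    fun k l => ?_
  by_cases hk : k = j
  · subst hk
    simp only [Function.update_self]
    exact contDiffOn_const
  · simp only [Function.update_of_ne hk]
    exact hg k l

theorem contDiffOn_christoffel (hV : IsOpen V) (hg : ∀ i j, ContDiffOn ℝ ∞ (g i j) V)
    (hdet : ∀ x ∈ V, (Matrix.of fun i j => g i j x).det ≠ 0) (k i j : ι) :
    ContDiffOn ℝ ∞ (christoffel b g k i j) V :=
  contDiffOn_const.mul <| ContDiffOn.sum fun l _ => (contDiffOn_invMetric hg hdet k l).mul
    (((contDiffOn_pd hV (hg _ _) _).add (contDiffOn_pd hV (hg _ _) _)).sub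
      (contDiffOn_pd hV (hg _ _) _))

theorem contDiffOn_riemann (hV : IsOpen V) (hg : ∀ i j, ContDiffOn ℝ ∞ (g i j) V)
    (hdet : ∀ x ∈ V, (Matrix.of fun i j => g i j x).det ≠ 0) (k l i j : ι) :
    ContDiffOn ℝ ∞ (riemann b g k l i j) V := by
  have h := contDiffOn_christoffel (b := b) hV hg hdet
  exact ((contDiffOn_pd hV (h _ _ _) _).sub (contDiffOn_pd hV (h _ _ _) _)).add <|
    ContDiffOn.sum fun m _ => ((h _ _ _).mul (h _ _ _)).sub ((h _ _ _).mul (h _ _ _))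

theorem contDiffOn_ricci (hV : IsOpen V) (hg : ∀ i j, ContDiffOn ℝ ∞ (g i j) V)
    (hdet : ∀ x ∈ V, (Matrix.of fun i j => g i j x).det ≠ 0) (k l : ι) :
    ContDiffOn ℝ ∞ (ricci b g k l) V :=
  ContDiffOn.sum fun _ _ => contDiffOn_riemann hV hg hdet _ _ _ _

theorem contDiffOn_scalarCurv (hV : IsOpen V) (hg : ∀ i j, ContDiffOn ℝ ∞ (g i j) V)
    (hdet : ∀ x ∈ V, (Matrix.of fun i j => g i j x).det ≠ 0) :
    ContDiffOn ℝ ∞ (scalarCurv b g) V :=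
  ContDiffOn.sum fun _ _ => ContDiffOn.sum fun _ _ =>
    (contDiffOn_invMetric hg hdet _ _).mul (contDiffOn_ricci hV hg hdet _ _)

end Smoothness

/-! ### Symmetry and metric compatibility of the connection. -/

section Symmetry

variable {ι E : Type*} [Fintype ι] [DecidableEq ι] [NormedAddCommGroup E] [NormedSpace ℝ E]
  {b : Module.Basis ι ℝ E} {V : Set E} {g : ι → ι → E → ℝ} {x : E}

theorem christoffel_symm (hV : IsOpen V) (hx : x ∈ V) (hs : ∀ y ∈ V, ∀ i j, g i j y = g j i y)
    (k i j : ι) : christoffel b g k i j x = christoffel b g k j i x := by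
  unfold christoffel
  congr 1
  refine Finset.sum_congr rfl fun l _ => ?_
  rw [pd_congr hV hx (fun y hy => hs y hy i j) l]
  ring

theorem mul_invMetric (hdet : (Matrix.of fun i j => g i j x).det ≠ 0) :
    (Matrix.of fun i j => g i j x) * (Matrix.of fun i j => invMetric g i j x) = 1 :=
  Matrix.mul_nonsing_inv _ (isUnit_iff_ne_zero.2 hdet)

theorem invMetric_mul (hdet : (Matrix.of fun i j => g i j x).det ≠ 0) :
    (Matrix.of fun i j => invMetric g i j x) * (Matrix.of fun i j => g i j x) = 1 :=
  Matrix.nonsing_inv_mul _ (isUnit_iff_ne_zero.2 hdet)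

theorem invMetric_symm (hs : ∀ i j, g i j x = g j i x) (i j : ι) :
    invMetric g i j x = invMetric g j i x := by
  have h : (Matrix.of fun i j => g i j x).transpose = Matrix.of fun i j => g i j x := by
    ext i j
    exact hs j i
  have h' := Matrix.transpose_nonsing_inv (Matrix.of fun i j => g i j x)
  rw [h] at h'
  exact congrFun (congrFun h' j) i

/-- Contracting with the metric cancels the inverse metric and leaves the Christoffel symbols of the
first kind. Two of these add up to a derivative of the metric, which is metric compatibility. -/
theorem sum_metric_mul_christoffel (hdet : (Matrix.of fun i j => g i j x).det ≠ 0) (k i l : ι) :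
    ∑ p, g k p x * christoffel b g p i l x
      = 1 / 2 * (pd b i (g l k) x + pd b l (g i k) x - pd b k (g i l) x) := by
  have h := mul_invMetric hdet
  have h' : ∀ q, ∑ p, g k p x * invMetric g p q x = if k = q then 1 else 0 := fun q => by
    have := congrFun (congrFun h k) q
    simpa [Matrix.mul_apply, Matrix.one_apply] using this
  simp only [christoffel, Finset.mul_sum]
  rw [Finset.sum_comm]
  calc _ = ∑ q, (∑ p, g k p x * invMetric g p q x) *
        (1 / 2 * (pd b i (g l q) x + pd b l (g i q) x - pd b q (g i l) x)) := by
        refine Finset.sum_congr rfl fun q _ => ?_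
        rw [Finset.sum_mul]
        refine Finset.sum_congr rfl fun p _ => ?_
        ring
    _ = _ := by simp [h']

/-- The Levi-Civita connection is metric: `∂_i g_{kl} = g_{kp} Γ^p_{il} + g_{lp} Γ^p_{ik}`. -/
theorem pd_metric (hV : IsOpen V) (hx : x ∈ V) (hs : ∀ y ∈ V, ∀ i j, g i j y = g j i y)
    (hdet : (Matrix.of fun i j => g i j x).det ≠ 0) (i k l : ι) :
    pd b i (g k l) x = ∑ p, g k p x * christoffel b g p i l x
      + ∑ p, christoffel b g p i k x * g p l x := by
  have h : ∑ p, christoffel b g p i k x * g p l x = ∑ p, g l p x * christoffel b g p i k x :=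
    Finset.sum_congr rfl fun p _ => by rw [hs x hx p l, mul_comm]
  rw [h, sum_metric_mul_christoffel hdet, sum_metric_mul_christoffel hdet,
    pd_congr hV hx (fun y hy => hs y hy l k) i, pd_congr hV hx (fun y hy => hs y hy i k) l,
    pd_congr hV hx (fun y hy => hs y hy i l) k]
  ring

end Symmetry

/-! ### The second Bianchi identity and Schur's lemma. -/

section Schur

/-- The contraction of the second Bianchi identity of an Einstein metric, with both indices of the
endomorphism part raised: `S i j k l` stands for `R^{kl}_{ij}` and `C m k l` for `Γ^k_{ml}`. -/
theorem einstein_contraction {ι : Type*} [Fintype ι] [DecidableEq ι] {S : ι → ι → ι → ι → ℝ}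
    {D : ι → ι → ι → ι → ι → ℝ} {C : ι → ι → ι → ℝ} {c : ℝ} {c' : ι → ℝ}
    (hS₁ : ∀ i j k l, S j i k l = -S i j k l) (hS₂ : ∀ i j k l, S i j l k = -S i j k l)
    (hD₁ : ∀ m i j k l, D m j i k l = -D m i j k l)
    (hD₂ : ∀ m i j k l, D m i j l k = -D m i j k l)
    (hC : ∀ i k l, C i k l = C l k i)
    (hcyc : ∀ m i j k l, D m i j k l + D i j m k l + D j m i k l
      + (∑ p, (C m k p * S i j p l + S i j k p * C m l p))
      + (∑ p, (C i k p * S j m p l + S j m k p * C i l p))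
      + (∑ p, (C j k p * S m i p l + S m i k p * C j l p)) = 0)
    (hSc : ∀ l q, ∑ m, S m l m q = if l = q then c else 0)
    (hDc : ∀ n l q, ∑ m, D n m l m q = if l = q then c' n else 0) (m : ι) :
    ((Fintype.card ι : ℝ) - 2) * c' m = 0 := by
  -- Contract the cyclic identity with k = i and l = j. The three derivative terms contribute
  -- card·c', -c' and -c', whence the factor card - 2; the six connection terms must cancel.
  have T1 : ∑ i, ∑ j, D m i j i j = Fintype.card ι * c' m := by
    rw [Finset.sum_comm]
    simp [hDc]
  have T2 : ∑ i, ∑ j, D i j m i j = -c' m := by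
    have : ∀ i, ∑ j, D i j m i j = -∑ j, D i j m j i := fun i => by
      rw [← Finset.sum_neg_distrib]
      exact Finset.sum_congr rfl fun j _ => hD₂ _ _ _ _ _
    simp [this, hDc]
  have T3 : ∑ i, ∑ j, D j m i i j = -c' m := by
    have : ∀ j, ∑ i, D j m i i j = -∑ i, D j i m i j := fun j => by
      rw [← Finset.sum_neg_distrib]
      exact Finset.sum_congr rfl fun i _ => hD₁ _ _ _ _ _
    rw [Finset.sum_comm]
    simp [this, hDc]
  have hS₁₂ : ∀ i j k l, S j i l k = S i j k l := fun i j k l => by rw [hS₁, hS₂, neg_neg]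
  -- In four of the connection terms the sum over S is a trace, so each is ±c times the trace of the
  -- connection: `G1` and `G1'` with a plus sign, `G2` and `G3'` with a minus sign.
  have G1 : ∑ i, ∑ j, ∑ p, C m i p * S i j p j = c * ∑ i, C m i i := by
    have : ∀ i, ∑ j, ∑ p, C m i p * S i j p j = c * C m i i := fun i => by
      rw [Finset.sum_comm]
      have : ∀ p, ∑ j, C m i p * S i j p j = C m i p * ∑ j, S j i j p := fun p => by
        rw [Finset.mul_sum]
        exact Finset.sum_congr rfl fun j _ => by rw [hS₁₂]
      simp only [this, hSc]
      simp [mul_comm]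
    simp [this, Finset.mul_sum]
  have G1' : ∑ i, ∑ j, ∑ p, S i j i p * C m j p = c * ∑ i, C m i i := by
    rw [Finset.sum_comm]
    have : ∀ j, ∑ i, ∑ p, S i j i p * C m j p = c * C m j j := fun j => by
      rw [Finset.sum_comm]
      simp [← Finset.sum_mul, hSc]
    simp [this, Finset.mul_sum]
  have G2 : ∑ i, ∑ j, ∑ p, C i i p * S j m p j = -(c * ∑ i, C m i i) := by
    have : ∀ i, ∑ j, ∑ p, C i i p * S j m p j = -(c * C m i i) := fun i => by
      rw [Finset.sum_comm]
      have : ∀ p, ∑ j, C i i p * S j m p j = -(C i i p * ∑ j, S j m j p) := fun p => by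
        rw [Finset.mul_sum, ← Finset.sum_neg_distrib]
        exact Finset.sum_congr rfl fun j _ => by rw [hS₂]; ring
      simp only [this, hSc]
      simp [mul_comm, hC i i m]
    simp [this, Finset.mul_sum]
  have G3' : ∑ i, ∑ j, ∑ p, S m i i p * C j j p = -(c * ∑ i, C m i i) := by
    rw [Finset.sum_comm]
    have : ∀ j, ∑ i, ∑ p, S m i i p * C j j p = -(c * C m j j) := fun j => by
      rw [Finset.sum_comm]
      have : ∀ p, ∑ i, S m i i p * C j j p = -((∑ i, S i m i p) * C j j p) := fun p => by
        rw [Finset.sum_mul, ← Finset.sum_neg_distrib]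
        exact Finset.sum_congr rfl fun i _ => by rw [hS₁]; ring
      simp [this, hSc, hC j j m]
    simp [this, Finset.mul_sum]
  -- In the last two terms the skew upper pair of S meets the symmetric lower pair of the
  -- connection.
  have G2' : ∑ i, ∑ j, ∑ p, S j m i p * C i j p = 0 := by
    have h : ∑ i, ∑ j, ∑ p, S j m i p * C i j p = -∑ i, ∑ j, ∑ p, S j m i p * C i j p := by
      conv_rhs => rw [Finset.sum_comm]
      conv_lhs => rw [Finset.sum_comm]
      rw [← Finset.sum_neg_distrib]
      refine Finset.sum_congr rfl fun j _ => ?_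
      conv_lhs => rw [Finset.sum_comm]
      rw [← Finset.sum_neg_distrib]
      refine Finset.sum_congr rfl fun i _ => ?_
      rw [← Finset.sum_neg_distrib]
      refine Finset.sum_congr rfl fun p _ => ?_
      rw [hS₂, hC p]; ring
    linarith
  have G3 : ∑ i, ∑ j, ∑ p, C j i p * S m i p j = 0 := by
    have h : ∑ i, ∑ j, ∑ p, C j i p * S m i p j = -∑ i, ∑ j, ∑ p, C j i p * S m i p j := by
      rw [← Finset.sum_neg_distrib]
      refine Finset.sum_congr rfl fun i _ => ?_
      conv_lhs => rw [Finset.sum_comm]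
      rw [← Finset.sum_neg_distrib]
      refine Finset.sum_congr rfl fun j _ => ?_
      rw [← Finset.sum_neg_distrib]
      refine Finset.sum_congr rfl fun p _ => ?_
      rw [hS₂, hC p]; ring
    linarith
  have h : ∑ i, ∑ j, (D m i j i j + D i j m i j + D j m i i j
      + (∑ p, (C m i p * S i j p j + S i j i p * C m j p))
      + (∑ p, (C i i p * S j m p j + S j m i p * C i j p))
      + (∑ p, (C j i p * S m i p j + S m i i p * C j j p))) = 0 :=
    Finset.sum_eq_zero fun i _ => Finset.sum_eq_zero fun j _ => hcyc m i j i j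
  simp only [Finset.sum_add_distrib] at h
  rw [T1, T2, T3, G1, G1', G2, G2', G3, G3'] at h
  linarith

variable {ι E : Type*} [Fintype ι] [DecidableEq ι] [NormedAddCommGroup E] [NormedSpace ℝ E]
  {b : Module.Basis ι ℝ E} {V : Set E} {g : ι → ι → E → ℝ} {x : E}

/-- The matrix of components at `x` of a matrix-valued function. -/
def matAt {ι E : Type*} (f : ι → ι → E → ℝ) (x : E) : Matrix ι ι ℝ := Matrix.of fun k l => f k l x

/-- The entrywise product of matrix-valued functions. -/
def mulFun (f f' : ι → ι → E → ℝ) : ι → ι → E → ℝ := fun k l x => ∑ p, f k p x * f' p l x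

/-- The entrywise partial derivative of a matrix-valued function. -/
def dmat (b : Module.Basis ι ℝ E) (i : ι) (f : ι → ι → E → ℝ) : ι → ι → E → ℝ :=
  fun k l => pd b i (f k l)

theorem matAt_mulFun (f f' : ι → ι → E → ℝ) : matAt (mulFun f f') x = matAt f x * matAt f' x := by
  ext k l
  simp [matAt, mulFun, Matrix.mul_apply]

theorem matAt_add (f f' : ι → ι → E → ℝ) :
    matAt (fun k l y => f k l y + f' k l y) x = matAt f x + matAt f' x := rfl

theorem matAt_sub (f f' : ι → ι → E → ℝ) :
    matAt (fun k l y => f k l y - f' k l y) x = matAt f x - matAt f' x := rfl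

theorem matAt_dmat_mulFun {f f' : ι → ι → E → ℝ} (hf : ∀ k l, DifferentiableAt ℝ (f k l) x)
    (hf' : ∀ k l, DifferentiableAt ℝ (f' k l) x) (i : ι) :
    matAt (dmat b i (mulFun f f')) x
      = matAt (dmat b i f) x * matAt f' x + matAt f x * matAt (dmat b i f') x := by
  ext k l
  simp only [matAt, dmat, Matrix.mul_apply, Matrix.of_apply, Matrix.add_apply]
  have h := pd_sum (b := b) Finset.univ (f := fun p y => f k p y * f' p l y)
    (fun p => (hf k p).mul (hf' p l)) i
  rw [← Finset.sum_add_distrib]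
  refine h.trans ?_
  exact Finset.sum_congr rfl fun p _ => pd_mul (hf k p) (hf' p l) i

theorem matAt_dmat_add {f f' : ι → ι → E → ℝ} (hf : ∀ k l, DifferentiableAt ℝ (f k l) x)
    (hf' : ∀ k l, DifferentiableAt ℝ (f' k l) x) (i : ι) :
    matAt (dmat b i (fun k l y => f k l y + f' k l y)) x
      = matAt (dmat b i f) x + matAt (dmat b i f') x := by
  ext k l
  exact pd_add (hf k l) (hf' k l) i

theorem matAt_dmat_sub {f f' : ι → ι → E → ℝ} (hf : ∀ k l, DifferentiableAt ℝ (f k l) x)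
    (hf' : ∀ k l, DifferentiableAt ℝ (f' k l) x) (i : ι) :
    matAt (dmat b i (fun k l y => f k l y - f' k l y)) x
      = matAt (dmat b i f) x - matAt (dmat b i f') x := by
  ext k l
  exact pd_sub (hf k l) (hf' k l) i

theorem matAt_dmat_congr (hV : IsOpen V) (hx : x ∈ V) {f f' : ι → ι → E → ℝ}
    (h : ∀ y ∈ V, matAt f y = matAt f' y) (i : ι) :
    matAt (dmat b i f) x = matAt (dmat b i f') x := by
  ext k l
  exact pd_congr hV hx (fun y hy => congrFun (congrFun (h y hy) k) l) i

theorem matAt_dmat_comm (hV : IsOpen V) (hx : x ∈ V) {f : ι → ι → E → ℝ}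
    (hf : ∀ k l, ContDiffOn ℝ ∞ (f k l) V) (i j : ι) :
    matAt (dmat b i (dmat b j f)) x = matAt (dmat b j (dmat b i f)) x := by
  ext k l
  exact pd_comm hV hx (hf k l) i j

/-- The connection matrices `Γ_i = (Γ^k_{il})`. -/
def connMat (b : Module.Basis ι ℝ E) (g : ι → ι → E → ℝ) (i : ι) : ι → ι → E → ℝ :=
  fun k l => christoffel b g k i l

/-- The curvature matrices `R_{ij} = (R^k_{lij})`. -/
def curvMat (b : Module.Basis ι ℝ E) (g : ι → ι → E → ℝ) (i j : ι) : ι → ι → E → ℝ :=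
  fun k l => riemann b g k l i j

theorem curvMat_eq (i j : ι) : curvMat b g i j = fun k l y =>
    (dmat b i (connMat b g j) k l y - dmat b j (connMat b g i) k l y)
      + (mulFun (connMat b g i) (connMat b g j) k l y
        - mulFun (connMat b g j) (connMat b g i) k l y) := by
  funext k l y
  simp only [curvMat, riemann, dmat, connMat, mulFun, Finset.sum_sub_distrib]

theorem matAt_curvMat (i j : ι) : matAt (curvMat b g i j) x =
    matAt (dmat b i (connMat b g j)) x - matAt (dmat b j (connMat b g i)) x
      + (matAt (connMat b g i) x * matAt (connMat b g j) x
        - matAt (connMat b g j) x * matAt (connMat b g i) x) := by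
  rw [curvMat_eq, matAt_add (fun k l y =>
    dmat b i (connMat b g j) k l y - dmat b j (connMat b g i) k l y), matAt_sub, matAt_sub,
    matAt_mulFun, matAt_mulFun]

theorem matAt_dmat_curvMat (hV : IsOpen V) (hx : x ∈ V) (hg : ∀ i j, ContDiffOn ℝ ∞ (g i j) V)
    (hdet : ∀ x ∈ V, (Matrix.of fun i j => g i j x).det ≠ 0) (m i j : ι) :
    matAt (dmat b m (curvMat b g i j)) x =
      matAt (dmat b m (dmat b i (connMat b g j))) x - matAt (dmat b m (dmat b j (connMat b g i))) x
      + ((matAt (dmat b m (connMat b g i)) x * matAt (connMat b g j) x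
          + matAt (connMat b g i) x * matAt (dmat b m (connMat b g j)) x)
        - (matAt (dmat b m (connMat b g j)) x * matAt (connMat b g i) x
          + matAt (connMat b g j) x * matAt (dmat b m (connMat b g i)) x)) := by
  have hC : ∀ i k l, DifferentiableAt ℝ (connMat b g i k l) x := fun i k l =>
    ContDiffOn.differentiableAt_of_isOpen hV hx (contDiffOn_christoffel hV hg hdet _ _ _)
  have hdC : ∀ i j k l, DifferentiableAt ℝ (dmat b i (connMat b g j) k l) x := fun i j k l =>
    ContDiffOn.differentiableAt_of_isOpen hV hx
      (contDiffOn_pd hV (contDiffOn_christoffel hV hg hdet _ _ _) _)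
  have hCC : ∀ i j k l, DifferentiableAt ℝ (mulFun (connMat b g i) (connMat b g j) k l) x :=
    fun i j k l => DifferentiableAt.fun_sum fun p _ => (hC _ _ _).mul (hC _ _ _)
  rw [curvMat_eq, matAt_dmat_add (f := fun k l y =>
      dmat b i (connMat b g j) k l y - dmat b j (connMat b g i) k l y)
      (f' := fun k l y => mulFun (connMat b g i) (connMat b g j) k l y
        - mulFun (connMat b g j) (connMat b g i) k l y)
      (fun k l => (hdC _ _ _ _).sub (hdC _ _ _ _)) (fun k l => (hCC _ _ _ _).sub (hCC _ _ _ _)),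
    matAt_dmat_sub (hdC _ _) (hdC _ _), matAt_dmat_sub (hCC _ _) (hCC _ _),
    matAt_dmat_mulFun (hC _) (hC _), matAt_dmat_mulFun (hC _) (hC _)]

/-- The second Bianchi identity. -/
theorem bianchi (hV : IsOpen V) (hx : x ∈ V) (hg : ∀ i j, ContDiffOn ℝ ∞ (g i j) V)
    (hdet : ∀ x ∈ V, (Matrix.of fun i j => g i j x).det ≠ 0) (m i j : ι) :
    let C := fun i => matAt (connMat b g i) x
    let R := fun i j => matAt (curvMat b g i j) x
    matAt (dmat b m (curvMat b g i j)) x + matAt (dmat b i (curvMat b g j m)) x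
        + matAt (dmat b j (curvMat b g m i)) x
      = (R i j * C m - C m * R i j) + (R j m * C i - C i * R j m) + (R m i * C j - C j * R m i) := by
  -- With R_ij = ∂_iΓ_j - ∂_jΓ_i + [Γ_i, Γ_j] as matrices, the second derivatives cancel in pairs in
  -- the cyclic sum. What remains is a noncommutative polynomial identity, whose cubic part is the
  -- Jacobi identity.
  have h : ∀ m i j, matAt (dmat b m (dmat b i (connMat b g j))) x
      = matAt (dmat b i (dmat b m (connMat b g j))) x := fun m i j =>
    matAt_dmat_comm hV hx (fun k l => contDiffOn_christoffel hV hg hdet _ _ _) m i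
  simp only [matAt_dmat_curvMat hV hx hg hdet, matAt_curvMat]
  rw [h i m, h j m, h j i]
  noncomm_ring

theorem matAt_dmat_metric (hV : IsOpen V) (hx : x ∈ V) (hs : ∀ y ∈ V, ∀ i j, g i j y = g j i y)
    (hdet : ∀ x ∈ V, (Matrix.of fun i j => g i j x).det ≠ 0) (i : ι) :
    matAt (dmat b i g) x = matAt g x * matAt (connMat b g i) x
      + (matAt (connMat b g i) x).transpose * matAt g x := by
  ext k l
  simpa [matAt, dmat, connMat, Matrix.mul_apply] using pd_metric hV hx hs (hdet x hx) i k l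

/-- The curvature matrices are skew with respect to the metric. -/
theorem metric_mul_curvMat (hV : IsOpen V) (hx : x ∈ V) (hg : ∀ i j, ContDiffOn ℝ ∞ (g i j) V)
    (hs : ∀ y ∈ V, ∀ i j, g i j y = g j i y)
    (hdet : ∀ x ∈ V, (Matrix.of fun i j => g i j x).det ≠ 0) (i j : ι) :
    matAt g x * matAt (curvMat b g i j) x
      + (matAt (curvMat b g i j) x).transpose * matAt g x = 0 := by
  have hC : ∀ i k l, DifferentiableAt ℝ (connMat b g i k l) x := fun i k l =>
    ContDiffOn.differentiableAt_of_isOpen hV hx (contDiffOn_christoffel hV hg hdet _ _ _)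
  have hgd : ∀ k l, DifferentiableAt ℝ (g k l) x := fun k l =>
    ContDiffOn.differentiableAt_of_isOpen hV hx (hg k l)
  have h : ∀ i j, matAt (dmat b i (dmat b j g)) x =
      matAt (dmat b i g) x * matAt (connMat b g j) x
        + matAt g x * matAt (dmat b i (connMat b g j)) x
        + ((matAt (dmat b i (connMat b g j)) x).transpose * matAt g x
        + (matAt (connMat b g j) x).transpose * matAt (dmat b i g) x) := by
    intro i j
    have h₁ : ∀ k l, DifferentiableAt ℝ (mulFun g (connMat b g j) k l) x := fun k l =>
      DifferentiableAt.fun_sum fun p _ => (hgd _ _).mul (hC _ _ _)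
    have h₂ : ∀ k l, DifferentiableAt ℝ (mulFun (fun k l => connMat b g j l k) g k l) x :=
      fun k l => DifferentiableAt.fun_sum fun p _ => (hC _ _ _).mul (hgd _ _)
    rw [matAt_dmat_congr hV hx (f' := fun k l y => mulFun g (connMat b g j) k l y
        + mulFun (fun k l => connMat b g j l k) g k l y)
        (fun y hy => by
          rw [matAt_dmat_metric hV hy hs hdet, matAt_add, matAt_mulFun, matAt_mulFun]; rfl),
      matAt_dmat_add h₁ h₂,
      matAt_dmat_mulFun hgd (hC j), matAt_dmat_mulFun (fun k l => hC j l k) hgd]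
    rfl
  -- Differentiate ∂_j g = gΓ_j + Γ_jᵀg once more: the antisymmetric part of ∂_i∂_j g, which
  -- vanishes, is gR_ij + R_ijᵀg.
  have hc := matAt_dmat_comm (b := b) hV hx hg i j
  rw [h, h, matAt_dmat_metric hV hx hs hdet, matAt_dmat_metric hV hx hs hdet] at hc
  rw [matAt_curvMat]
  rw [← sub_eq_zero] at hc
  rw [← hc]
  simp only [Matrix.transpose_add, Matrix.transpose_sub, Matrix.transpose_mul]
  noncomm_ring

/-- Schur's lemma: the Einstein factor of a metric in dimension other than two is locally
constant. -/
theorem schur (hV : IsOpen V) (hx : x ∈ V) (hg : ∀ i j, ContDiffOn ℝ ∞ (g i j) V)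
    (hs : ∀ y ∈ V, ∀ i j, g i j y = g j i y)
    (hdet : ∀ x ∈ V, (Matrix.of fun i j => g i j x).det ≠ 0) (hcard : Fintype.card ι ≠ 2)
    {c : E → ℝ} (hc : ∀ y ∈ V, ∀ k l, ricci b g k l y = c y * g k l y) (m : ι) :
    pd b m c x = 0 := by
  have hmul : ∀ y ∈ V, matAt g y * matAt (invMetric g) y = 1 := fun y hy =>
    mul_invMetric (hdet y hy)
  have hmul' : ∀ y ∈ V, matAt (invMetric g) y * matAt g y = 1 := fun y hy =>
    invMetric_mul (hdet y hy)
  have hgd : ∀ k l, DifferentiableAt ℝ (g k l) x := fun k l =>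
    ContDiffOn.differentiableAt_of_isOpen hV hx (hg k l)
  have hid : ∀ k l, DifferentiableAt ℝ (invMetric g k l) x := fun k l =>
    ContDiffOn.differentiableAt_of_isOpen hV hx (contDiffOn_invMetric hg hdet k l)
  have hRd : ∀ i j k l, DifferentiableAt ℝ (curvMat b g i j k l) x := fun i j k l =>
    ContDiffOn.differentiableAt_of_isOpen hV hx (contDiffOn_riemann hV hg hdet _ _ _ _)
  -- Differentiate g⁻¹g = 1 and insert metric compatibility.
  have hdinv : ∀ m, matAt (dmat b m (invMetric g)) x
      = -(matAt (connMat b g m) x * matAt (invMetric g) x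
        + matAt (invMetric g) x * (matAt (connMat b g m) x).transpose) := by
    intro m
    have h1 := matAt_dmat_mulFun (b := b) hid hgd m
    rw [matAt_dmat_congr hV hx (f' := fun k l _ => (1 : Matrix ι ι ℝ) k l)
      (fun y hy => by rw [matAt_mulFun, hmul' y hy]; rfl)] at h1
    have h0 : matAt (dmat b m fun k l _ => (1 : Matrix ι ι ℝ) k l) x = 0 := by
      ext k l
      exact pd_const _ _
    rw [h0, matAt_dmat_metric hV hx hs hdet] at h1
    have h2 := congrArg (· * matAt (invMetric g) x) h1
    simp only [zero_mul, add_mul, mul_add, mul_assoc, hmul x hx, mul_one] at h2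
    rw [← mul_assoc (matAt (invMetric g) x) (matAt g x), hmul' x hx, one_mul] at h2
    rw [eq_neg_iff_add_eq_zero]
    exact h2.symm
  have hcanti : ∀ i j, curvMat b g j i = fun k l y => -curvMat b g i j k l y := by
    intro i j
    rw [curvMat_eq, curvMat_eq]
    funext k l y
    ring
  -- With both endomorphism indices raised, the Einstein condition says that a trace of S is c times
  -- the Kronecker delta, so partial derivatives of this trace involve no derivative of the metric.
  let S : ι → ι → ι → ι → E → ℝ := fun i j => mulFun (curvMat b g i j) (invMetric g)
  have hSc : ∀ y ∈ V, ∀ l q, ∑ m, S m l m q y = if l = q then c y else 0 := by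
    intro y hy l q
    simp only [S, mulFun]
    rw [Finset.sum_comm]
    have h1 : ∀ p, ∑ m, curvMat b g m l m p y * invMetric g p q y
        = c y * (g l p y * invMetric g p q y) := by
      intro p
      rw [← Finset.sum_mul]
      have := hc y hy p l
      rw [ricci] at this
      simp only [curvMat]
      rw [this, hs y hy]
      ring
    simp only [h1, ← Finset.mul_sum]
    have := congrFun (congrFun (hmul y hy) l) q
    simp only [matAt, Matrix.mul_apply, Matrix.of_apply, Matrix.one_apply] at this
    rw [this]
    simp
  have hSanti : ∀ y ∈ V, ∀ i j k l, S i j l k y = -S i j k l y := by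
    intro y hy i j k l
    have h := metric_mul_curvMat (b := b) hV hy hg hs hdet i j
    have h2 := congrArg (fun A => matAt (invMetric g) y * A * matAt (invMetric g) y) h
    simp only [mul_zero, zero_mul, add_mul, mul_add] at h2
    rw [← mul_assoc, hmul' y hy, one_mul, mul_assoc (matAt (invMetric g) y), mul_assoc _ (matAt g y),
      hmul y hy, mul_one] at h2
    have hinv : (matAt (invMetric g) y).transpose = matAt (invMetric g) y := by
      ext i j
      exact invMetric_symm (hs y hy) j i
    have h3 : matAt (S i j) y + (matAt (S i j) y).transpose = 0 := by
      simp only [S]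
      rw [matAt_mulFun, Matrix.transpose_mul, hinv]
      exact h2
    have := congrFun (congrFun h3 k) l
    simp only [matAt, Matrix.add_apply, Matrix.of_apply, Matrix.transpose_apply,
      Matrix.zero_apply] at this
    linarith
  have hSd : ∀ i j k l, DifferentiableAt ℝ (S i j k l) x := fun i j k l =>
    DifferentiableAt.fun_sum fun p _ => (hRd _ _ _ _).mul (hid _ _)
  have hSswap : ∀ i j k l, S j i k l = fun y => -S i j k l y := by
    intro i j k l
    funext y
    simp only [S, mulFun, hcanti i j, neg_mul, Finset.sum_neg_distrib]
  have key := einstein_contraction (S := fun i j k l => S i j k l x)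
    (D := fun m i j k l => pd b m (S i j k l) x) (C := fun i k l => christoffel b g k i l x)
    (c := c x) (c' := fun m => pd b m c x)
    (fun i j k l => congrFun (hSswap i j k l) x)
    (fun i j k l => hSanti x hx i j k l)
    (fun m i j k l => by
      simp only [hSswap i j k l, pd, fderiv_fun_neg, neg_apply])
    (fun m i j k l => by
      rw [pd_congr hV hx (fun y hy => hSanti y hy i j k l)]
      simp only [pd, fderiv_fun_neg, neg_apply])
    (fun i k l => christoffel_symm hV hx hs k i l)
    (by
      intro m i j k l
      have hb := congrArg (· * matAt (invMetric g) x) (bianchi (b := b) hV hx hg hdet m i j)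
      have hdS : ∀ m i j, matAt (dmat b m (S i j)) x
          = matAt (dmat b m (curvMat b g i j)) x * matAt (invMetric g) x
            + matAt (curvMat b g i j) x * matAt (dmat b m (invMetric g)) x := fun m i j =>
        matAt_dmat_mulFun (hRd i j) hid m
      -- This is the Bianchi identity multiplied on the right by g⁻¹; the derivative of g⁻¹ supplies
      -- the connection term for the second raised index. The form indices need none, because those
      -- terms cancel in the cyclic sum.
      have hcyc : matAt (dmat b m (S i j)) x + matAt (dmat b i (S j m)) x
          + matAt (dmat b j (S m i)) x
          + (matAt (connMat b g m) x * matAt (S i j) x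
            + matAt (S i j) x * (matAt (connMat b g m) x).transpose)
          + (matAt (connMat b g i) x * matAt (S j m) x
            + matAt (S j m) x * (matAt (connMat b g i) x).transpose)
          + (matAt (connMat b g j) x * matAt (S m i) x
            + matAt (S m i) x * (matAt (connMat b g j) x).transpose) = 0 := by
        rw [hdS, hdS, hdS, hdinv, hdinv, hdinv]
        simp only [S, matAt_mulFun]
        simp only at hb
        rw [← sub_eq_zero] at hb
        rw [← hb]
        noncomm_ring
      have := congrFun (congrFun hcyc k) l
      simpa only [matAt, dmat, connMat, Matrix.mul_apply, Matrix.of_apply, Matrix.add_apply,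
        Matrix.transpose_apply, Matrix.zero_apply, ← Finset.sum_add_distrib] using this)
    (hSc x hx)
    (by
      intro n l q
      rw [← pd_sum _ (fun m => hSd m l m q), pd_congr hV hx (fun y hy => hSc y hy l q)]
      split_ifs
      · rfl
      · exact pd_const _ _)
    m
  refine (mul_eq_zero.1 key).resolve_left (sub_ne_zero.2 ?_)
  exact_mod_cast hcard

end Schur

/-! ### Connection of a warped product in coordinates. -/

section WarpedCoordinates

variable {κ E : Type*} [Fintype κ] [DecidableEq κ] [NormedAddCommGroup E] [NormedSpace ℝ E]

/-- The basis of `ℝ × E` consisting of the time direction and a basis of `E`. -/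
abbrev timeBasis (b : Module.Basis κ ℝ E) : Module.Basis (Unit ⊕ κ) ℝ (ℝ × E) :=
  (Module.Basis.singleton Unit ℝ).prod b

/-- The functions `G` are the components on `T × V` of the metric `-dt² + a(t)² h`. -/
structure IsWarped (T : Set ℝ) (V : Set E) (a : ℝ → ℝ) (h : κ → κ → E → ℝ)
    (G : Unit ⊕ κ → Unit ⊕ κ → ℝ × E → ℝ) : Prop where
  isOpen_time : IsOpen T
  isOpen_space : IsOpen V
  smooth_scale : ContDiffOn ℝ ∞ a T
  scale_ne_zero : ∀ t ∈ T, a t ≠ 0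
  smooth_metric : ∀ i j, ContDiffOn ℝ ∞ (h i j) V
  symm : ∀ y ∈ V, ∀ i j, h i j y = h j i y
  det_ne_zero : ∀ y ∈ V, (Matrix.of fun i j => h i j y).det ≠ 0
  inl_inl : ∀ t ∈ T, ∀ y ∈ V, ∀ u v, G (.inl u) (.inl v) (t, y) = -1
  inl_inr : ∀ t ∈ T, ∀ y ∈ V, ∀ u j, G (.inl u) (.inr j) (t, y) = 0
  inr_inl : ∀ t ∈ T, ∀ y ∈ V, ∀ i v, G (.inr i) (.inl v) (t, y) = 0
  inr_inr : ∀ t ∈ T, ∀ y ∈ V, ∀ i j, G (.inr i) (.inr j) (t, y) = a t ^ 2 * h i j y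

/-- A partial derivative sees only the restriction to a coordinate line, so closed formulas valid on
T × {y} can be differentiated in one variable. `pd_inr` is the counterpart for the slices {t} × V.
-/
theorem pd_inl {b : Module.Basis κ ℝ E} {T : Set ℝ} (hT : IsOpen T) {t : ℝ} (ht : t ∈ T) {y : E}
    {f : ℝ × E → ℝ} (hf : DifferentiableAt ℝ f (t, y)) {φ : ℝ → ℝ} {φ' : ℝ}
    (hφ : ∀ s ∈ T, f (s, y) = φ s) (hφ' : HasDerivAt φ φ' t) (u : Unit) :
    pd (timeBasis b) (.inl u) f (t, y) = φ' := by
  have h1 : HasDerivAt (fun s : ℝ => (s, y)) ((1 : ℝ), (0 : E)) t :=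
    (hasDerivAt_id t).prodMk (hasDerivAt_const t y)
  have h2 : HasDerivAt (fun s => f (s, y)) (fderiv ℝ f (t, y) (1, 0)) t :=
    hf.hasFDerivAt.comp_hasDerivAt t h1
  have h3 : HasDerivAt (fun s => f (s, y)) φ' t :=
    hφ'.congr_of_eventuallyEq (Set.EqOn.eventuallyEq_of_mem hφ (hT.mem_nhds ht))
  have : timeBasis b (.inl u) = ((1 : ℝ), (0 : E)) := by
    simp [timeBasis, Module.Basis.prod_apply]
  rw [pd, this]
  exact h2.unique h3

theorem pd_inr {b : Module.Basis κ ℝ E} {V : Set E} (hV : IsOpen V) {t : ℝ} {y : E} (hy : y ∈ V)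
    {f : ℝ × E → ℝ} (hf : DifferentiableAt ℝ f (t, y)) {ψ : E → ℝ}
    (hψ : ∀ z ∈ V, f (t, z) = ψ z) (i : κ) :
    pd (timeBasis b) (.inr i) f (t, y) = pd b i ψ y := by
  have h1 : HasFDerivAt (fun z : E => (t, z)) (ContinuousLinearMap.inr ℝ ℝ E) y :=
    (hasFDerivAt_const t y).prodMk (hasFDerivAt_id y)
  have h2 := (HasFDerivAt.comp y hf.hasFDerivAt h1).fderiv
  have h3 : timeBasis b (.inr i) = ((0 : ℝ), b i) := by
    simp [timeBasis, Module.Basis.prod_apply]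
  rw [← pd_congr hV hy (f := fun z => f (t, z)) hψ, pd, pd, h3]
  change _ = fderiv ℝ (f ∘ fun z : E => (t, z)) y (b i)
  rw [h2]
  simp

theorem pd_const_mul {ι E : Type*} [NormedAddCommGroup E] [NormedSpace ℝ E]
    {b : Module.Basis ι ℝ E} {x : E} (c : ℝ) {f : E → ℝ} (hf : DifferentiableAt ℝ f x) (i : ι) :
    pd b i (fun y => c * f y) x = c * pd b i f x := by
  simp [pd, fderiv_const_mul hf]

/-- The Hubble parameter `ȧ / a`. -/
def hubble (a : ℝ → ℝ) (t : ℝ) : ℝ := deriv a t / a t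

/-- The factor of `g*` in the spatial part of the Ricci tensor of a warped product. -/
def ricciFactor (d : ℝ) (a : ℝ → ℝ) (t : ℝ) : ℝ :=
  (d - 1) * deriv a t ^ 2 + a t * deriv (deriv a) t

/-- The eigenvalue of the Ricci tensor of a warped product in the time direction. -/
def timeEigenvalue (d : ℝ) (a : ℝ → ℝ) (t : ℝ) : ℝ := d * deriv (deriv a) t / a t

namespace IsWarped

variable {b : Module.Basis κ ℝ E} {T : Set ℝ} {V : Set E} {a : ℝ → ℝ} {h : κ → κ → E → ℝ}
  {G : Unit ⊕ κ → Unit ⊕ κ → ℝ × E → ℝ} {t : ℝ} {y : E}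

theorem hasDerivAt_scale (W : IsWarped T V a h G) (ht : t ∈ T) : HasDerivAt a (deriv a t) t :=
  (ContDiffOn.differentiableAt_of_isOpen W.isOpen_time ht W.smooth_scale).hasDerivAt

theorem smooth_deriv (W : IsWarped T V a h G) : ContDiffOn ℝ ∞ (deriv a) T :=
  W.smooth_scale.deriv_of_isOpen W.isOpen_time le_rfl

theorem hasDerivAt_deriv (W : IsWarped T V a h G) (ht : t ∈ T) :
    HasDerivAt (deriv a) (deriv (deriv a) t) t :=
  (ContDiffOn.differentiableAt_of_isOpen W.isOpen_time ht W.smooth_deriv).hasDerivAt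

theorem hasDerivAt_deriv_deriv (W : IsWarped T V a h G) (ht : t ∈ T) :
    HasDerivAt (deriv (deriv a)) (deriv (deriv (deriv a)) t) t :=
  (ContDiffOn.differentiableAt_of_isOpen W.isOpen_time ht
    (W.smooth_deriv.deriv_of_isOpen W.isOpen_time le_rfl)).hasDerivAt

theorem isOpen (W : IsWarped T V a h G) : IsOpen (T ×ˢ V) := W.isOpen_time.prod W.isOpen_space

theorem contDiffOn (W : IsWarped T V a h G) (i j : Unit ⊕ κ) :
    ContDiffOn ℝ ∞ (G i j) (T ×ˢ V) := by
  rcases i with u | i <;> rcases j with v | j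
  · exact contDiffOn_const.congr fun p hp => W.inl_inl p.1 hp.1 p.2 hp.2 u v
  · exact contDiffOn_const.congr fun p hp => W.inl_inr p.1 hp.1 p.2 hp.2 u j
  · exact contDiffOn_const.congr fun p hp => W.inr_inl p.1 hp.1 p.2 hp.2 i v
  · refine ContDiffOn.congr (f := fun p => a p.1 ^ 2 * h i j p.2) ?_
      fun p hp => W.inr_inr p.1 hp.1 p.2 hp.2 i j
    exact ((W.smooth_scale.comp contDiffOn_fst fun p hp => hp.1).pow 2).mul
      ((W.smooth_metric i j).comp contDiffOn_snd fun p hp => hp.2)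

/-- The inverse of the matrix of components of a warped metric. -/
theorem mul_inverse (W : IsWarped T V a h G) (ht : t ∈ T) (hy : y ∈ V) :
    (Matrix.of fun i j => G i j (t, y)) *
      Matrix.fromBlocks (-1) 0 0 ((a t ^ 2)⁻¹ • Matrix.of fun i j => invMetric h i j y) = 1 := by
  have hG : (Matrix.of fun i j => G i j (t, y))
      = Matrix.fromBlocks (-1) 0 0 ((a t ^ 2) • Matrix.of fun i j => h i j y) := by
    ext i j
    rcases i with u | i <;> rcases j with v | j
    · simp [W.inl_inl t ht y hy]
    · simp [W.inl_inr t ht y hy]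
    · simp [W.inr_inl t ht y hy]
    · simp [W.inr_inr t ht y hy]
  have ha : a t ^ 2 ≠ 0 := pow_ne_zero 2 (W.scale_ne_zero t ht)
  have hh : ((a t ^ 2) • Matrix.of fun i j => h i j y) *
      ((a t ^ 2)⁻¹ • Matrix.of fun i j => invMetric h i j y) = 1 := by
    rw [Matrix.smul_mul, Matrix.mul_smul, mul_invMetric (W.det_ne_zero y hy), smul_smul,
      mul_inv_cancel₀ ha, one_smul]
  rw [hG, Matrix.fromBlocks_multiply, hh]
  simp

theorem det_ne_zero_warped (W : IsWarped T V a h G) :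
    ∀ p ∈ T ×ˢ V, (Matrix.of fun i j => G i j p).det ≠ 0 := fun _ hp =>
  (Matrix.isUnit_det_of_right_inverse (W.mul_inverse hp.1 hp.2)).ne_zero

theorem invMetric_eq (W : IsWarped T V a h G) (ht : t ∈ T) (hy : y ∈ V) (i j : Unit ⊕ κ) :
    invMetric G i j (t, y) =
      Matrix.fromBlocks (-1) 0 0 ((a t ^ 2)⁻¹ • Matrix.of fun i j => invMetric h i j y) i j := by
  rw [invMetric, Matrix.inv_eq_right_inv (W.mul_inverse ht hy)]

theorem invMetric_inl_inl (W : IsWarped T V a h G) (ht : t ∈ T) (hy : y ∈ V) (u v : Unit) :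
    invMetric G (.inl u) (.inl v) (t, y) = -1 := by
  simp [W.invMetric_eq ht hy]

theorem invMetric_inl_inr (W : IsWarped T V a h G) (ht : t ∈ T) (hy : y ∈ V) (u : Unit) (j : κ) :
    invMetric G (.inl u) (.inr j) (t, y) = 0 := by
  simp [W.invMetric_eq ht hy]

theorem invMetric_inr_inl (W : IsWarped T V a h G) (ht : t ∈ T) (hy : y ∈ V) (i : κ) (v : Unit) :
    invMetric G (.inr i) (.inl v) (t, y) = 0 := by
  simp [W.invMetric_eq ht hy]

theorem invMetric_inr_inr (W : IsWarped T V a h G) (ht : t ∈ T) (hy : y ∈ V) (i j : κ) :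
    invMetric G (.inr i) (.inr j) (t, y) = (a t ^ 2)⁻¹ * invMetric h i j y := by
  simp [W.invMetric_eq ht hy]

theorem differentiableAt (W : IsWarped T V a h G) (ht : t ∈ T) (hy : y ∈ V)
    {f : ℝ × E → ℝ} (hf : ContDiffOn ℝ ∞ f (T ×ˢ V)) : DifferentiableAt ℝ f (t, y) :=
  ContDiffOn.differentiableAt_of_isOpen W.isOpen ⟨ht, hy⟩ hf

theorem differentiableAt_space (W : IsWarped T V a h G) (hy : y ∈ V)
    {f : E → ℝ} (hf : ContDiffOn ℝ ∞ f V) : DifferentiableAt ℝ f y :=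
  ContDiffOn.differentiableAt_of_isOpen W.isOpen_space hy hf

theorem pd_of_const (W : IsWarped T V a h G) (ht : t ∈ T) (hy : y ∈ V)
    {f : ℝ × E → ℝ} {c : ℝ} (hf : ∀ t ∈ T, ∀ y ∈ V, f (t, y) = c) (i : Unit ⊕ κ) :
    pd (timeBasis b) i f (t, y) = 0 :=
  (pd_congr W.isOpen (Set.mk_mem_prod ht hy) (fun p hp => hf p.1 hp.1 p.2 hp.2) i).trans
    (pd_const c i)

theorem pd_inl_inr_inr (W : IsWarped T V a h G) (ht : t ∈ T) (hy : y ∈ V) (u : Unit) (i j : κ) :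
    pd (timeBasis b) (.inl u) (G (.inr i) (.inr j)) (t, y) = 2 * a t * deriv a t * h i j y := by
  refine pd_inl W.isOpen_time ht (W.differentiableAt ht hy (W.contDiffOn _ _))
    (fun s hs => W.inr_inr s hs y hy i j) ?_ u
  exact (((W.hasDerivAt_scale ht).pow 2).mul_const (h i j y)).congr_deriv (by push_cast; ring)

theorem pd_inr_inr_inr (W : IsWarped T V a h G) (ht : t ∈ T) (hy : y ∈ V) (l i j : κ) :
    pd (timeBasis b) (.inr l) (G (.inr i) (.inr j)) (t, y) = a t ^ 2 * pd b l (h i j) y := by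
  rw [pd_inr W.isOpen_space hy (W.differentiableAt ht hy (W.contDiffOn _ _))
    (fun z hz => W.inr_inr t ht z hz i j) l,
    pd_const_mul _ (W.differentiableAt_space hy (W.smooth_metric i j))]

theorem christoffel_time (W : IsWarped T V a h G) (ht : t ∈ T) (hy : y ∈ V) (u : Unit)
    (i j : Unit ⊕ κ) : christoffel (timeBasis b) G (.inl u) i j (t, y) =
      -(1 / 2) * (pd (timeBasis b) i (G j (.inl u)) (t, y)
        + pd (timeBasis b) j (G i (.inl u)) (t, y) - pd (timeBasis b) (.inl u) (G i j) (t, y)) := by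
  simp only [christoffel, Fintype.sum_sum_type, W.invMetric_inl_inl ht hy,
    W.invMetric_inl_inr ht hy, zero_mul, Finset.sum_const_zero, add_zero, Finset.univ_unique,
    Finset.sum_singleton]
  cases u
  ring

theorem christoffel_space (W : IsWarped T V a h G) (ht : t ∈ T) (hy : y ∈ V) (k : κ)
    (i j : Unit ⊕ κ) : christoffel (timeBasis b) G (.inr k) i j (t, y) =
      1 / 2 * ∑ l, (a t ^ 2)⁻¹ * invMetric h k l y * (pd (timeBasis b) i (G j (.inr l)) (t, y)
        + pd (timeBasis b) j (G i (.inr l)) (t, y) - pd (timeBasis b) (.inr l) (G i j) (t, y)) := by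
  simp only [christoffel, Fintype.sum_sum_type, W.invMetric_inr_inl ht hy,
    W.invMetric_inr_inr ht hy, zero_mul, Finset.sum_const_zero, zero_add]

theorem pd_inl_inl (W : IsWarped T V a h G) (ht : t ∈ T) (hy : y ∈ V) (i : Unit ⊕ κ)
    (u v : Unit) : pd (timeBasis b) i (G (.inl u) (.inl v)) (t, y) = 0 :=
  W.pd_of_const ht hy (fun t ht y hy => W.inl_inl t ht y hy u v) i

theorem pd_inl_inr (W : IsWarped T V a h G) (ht : t ∈ T) (hy : y ∈ V) (i : Unit ⊕ κ) (u : Unit)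
    (j : κ) : pd (timeBasis b) i (G (.inl u) (.inr j)) (t, y) = 0 :=
  W.pd_of_const ht hy (fun t ht y hy => W.inl_inr t ht y hy u j) i

theorem pd_inr_inl (W : IsWarped T V a h G) (ht : t ∈ T) (hy : y ∈ V) (i : Unit ⊕ κ) (u : Unit)
    (j : κ) : pd (timeBasis b) i (G (.inr j) (.inl u)) (t, y) = 0 :=
  W.pd_of_const ht hy (fun t ht y hy => W.inr_inl t ht y hy j u) i

theorem christoffel_inl_inl (W : IsWarped T V a h G) (ht : t ∈ T) (hy : y ∈ V) (u v : Unit)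
    (i : Unit ⊕ κ) : christoffel (timeBasis b) G (.inl u) (.inl v) i (t, y) = 0 := by
  cases u; cases v
  rw [W.christoffel_time ht hy, W.pd_inl_inl ht hy]
  rcases i with i | i
  · cases i
    rw [W.pd_inl_inl ht hy]; simp
  · rw [W.pd_inr_inl ht hy, W.pd_inl_inr ht hy]; simp

theorem christoffel_inl_inr_inl (W : IsWarped T V a h G) (ht : t ∈ T) (hy : y ∈ V) (u v : Unit)
    (i : κ) : christoffel (timeBasis b) G (.inl u) (.inr i) (.inl v) (t, y) = 0 := by
  rw [W.christoffel_time ht hy, W.pd_inl_inl ht hy, W.pd_inr_inl ht hy]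
  simp

theorem christoffel_inl_inr_inr (W : IsWarped T V a h G) (ht : t ∈ T) (hy : y ∈ V) (u : Unit)
    (i j : κ) : christoffel (timeBasis b) G (.inl u) (.inr i) (.inr j) (t, y)
      = a t * deriv a t * h i j y := by
  rw [W.christoffel_time ht hy, W.pd_inr_inl ht hy, W.pd_inr_inl ht hy, W.pd_inl_inr_inr ht hy]
  ring

theorem christoffel_inr_inl_inl (W : IsWarped T V a h G) (ht : t ∈ T) (hy : y ∈ V) (k : κ)
    (u v : Unit) : christoffel (timeBasis b) G (.inr k) (.inl u) (.inl v) (t, y) = 0 := by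
  rw [W.christoffel_space ht hy]
  simp [W.pd_inl_inl ht hy, W.pd_inl_inr ht hy]

theorem sum_invMetric_mul (W : IsWarped T V a h G) (hy : y ∈ V) (k j : κ) :
    ∑ l, invMetric h k l y * h j l y = if k = j then 1 else 0 := by
  have := congrFun (congrFun (invMetric_mul (W.det_ne_zero y hy)) k) j
  simp only [Matrix.mul_apply, Matrix.of_apply, Matrix.one_apply] at this
  rw [← this]
  exact Finset.sum_congr rfl fun l _ => by rw [W.symm y hy j l]

theorem christoffel_inr_inl_inr (W : IsWarped T V a h G) (ht : t ∈ T) (hy : y ∈ V) (k j : κ)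
    (u : Unit) : christoffel (timeBasis b) G (.inr k) (.inl u) (.inr j) (t, y)
      = if k = j then hubble a t else 0 := by
  have ha := W.scale_ne_zero t ht
  rw [W.christoffel_space ht hy]
  simp only [W.pd_inl_inr_inr ht hy, W.pd_inl_inr ht hy]
  calc _ = hubble a t * ∑ l, invMetric h k l y * h j l y := by
        rw [Finset.mul_sum, Finset.mul_sum]
        refine Finset.sum_congr rfl fun l _ => ?_
        unfold hubble
        field_simp
        ring
    _ = _ := by rw [W.sum_invMetric_mul hy]; simp

theorem symm_warped (W : IsWarped T V a h G) :
    ∀ p ∈ T ×ˢ V, ∀ i j, G i j p = G j i p := by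
  rintro ⟨t, y⟩ ⟨ht, hy⟩ i j
  dsimp only at ht hy
  rcases i with u | i <;> rcases j with v | j
  · rfl
  · rw [W.inl_inr t ht y hy, W.inr_inl t ht y hy]
  · rw [W.inl_inr t ht y hy, W.inr_inl t ht y hy]
  · rw [W.inr_inr t ht y hy, W.inr_inr t ht y hy, W.symm y hy]

theorem christoffel_inr_inr_inl (W : IsWarped T V a h G) (ht : t ∈ T) (hy : y ∈ V) (k j : κ)
    (u : Unit) : christoffel (timeBasis b) G (.inr k) (.inr j) (.inl u) (t, y)
      = if k = j then hubble a t else 0 := by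
  rw [christoffel_symm W.isOpen (Set.mk_mem_prod ht hy) W.symm_warped,
    W.christoffel_inr_inl_inr ht hy]

theorem christoffel_inr_inr_inr (W : IsWarped T V a h G) (ht : t ∈ T) (hy : y ∈ V) (k i j : κ) :
    christoffel (timeBasis b) G (.inr k) (.inr i) (.inr j) (t, y) = christoffel b h k i j y := by
  have ha := W.scale_ne_zero t ht
  rw [W.christoffel_space ht hy, christoffel]
  congr 1
  refine Finset.sum_congr rfl fun l _ => ?_
  rw [W.pd_inr_inr_inr ht hy, W.pd_inr_inr_inr ht hy, W.pd_inr_inr_inr ht hy]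
  field_simp

end IsWarped
end WarpedCoordinates

/-! ### Curvature of a warped product and the gradient of its Ricci tensor. -/

section WarpedCurvature

namespace IsWarped

variable {κ E : Type*} [Fintype κ] [DecidableEq κ] [NormedAddCommGroup E] [NormedSpace ℝ E]
  {b : Module.Basis κ ℝ E} {T : Set ℝ} {V : Set E} {a : ℝ → ℝ} {h : κ → κ → E → ℝ}
  {G : Unit ⊕ κ → Unit ⊕ κ → ℝ × E → ℝ} {t : ℝ} {y : E}

theorem hasDerivAt_hubble (W : IsWarped T V a h G) (ht : t ∈ T) :
    HasDerivAt (hubble a) (deriv (deriv a) t / a t - hubble a t ^ 2) t := by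
  have ha := W.scale_ne_zero t ht
  refine ((W.hasDerivAt_deriv ht).div (W.hasDerivAt_scale ht) ha).congr_deriv ?_
  unfold hubble
  field_simp

theorem hasDerivAt_ricciFactor (W : IsWarped T V a h G) (ht : t ∈ T) (d : ℝ) :
    HasDerivAt (ricciFactor d a)
      ((2 * d - 1) * deriv a t * deriv (deriv a) t + a t * deriv (deriv (deriv a)) t) t := by
  refine ((((W.hasDerivAt_deriv ht).pow 2).const_mul (d - 1)).add
    ((W.hasDerivAt_scale ht).mul (W.hasDerivAt_deriv_deriv ht))).congr_deriv ?_
  push_cast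
  ring

theorem hasDerivAt_timeEigenvalue (W : IsWarped T V a h G) (ht : t ∈ T) (d : ℝ) :
    HasDerivAt (timeEigenvalue d a)
      (d * (deriv (deriv (deriv a)) t / a t - deriv (deriv a) t * deriv a t / a t ^ 2)) t := by
  have ha := W.scale_ne_zero t ht
  refine (((W.hasDerivAt_deriv_deriv ht).const_mul d).div (W.hasDerivAt_scale ht) ha).congr_deriv ?_
  field_simp

theorem differentiableAt_christoffel (W : IsWarped T V a h G) (ht : t ∈ T) (hy : y ∈ V)
    (k i j : Unit ⊕ κ) : DifferentiableAt ℝ (christoffel (timeBasis b) G k i j) (t, y) :=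
  W.differentiableAt ht hy
    (contDiffOn_christoffel W.isOpen W.contDiffOn W.det_ne_zero_warped k i j)

theorem pd_christoffel_inl_inl (W : IsWarped T V a h G) (ht : t ∈ T) (hy : y ∈ V)
    (l i : Unit ⊕ κ) (u v : Unit) :
    pd (timeBasis b) l (christoffel (timeBasis b) G (.inl u) (.inl v) i) (t, y) = 0 :=
  W.pd_of_const ht hy (fun _ ht _ hy => W.christoffel_inl_inl ht hy u v i) l

theorem pd_christoffel_inl_inr_inl (W : IsWarped T V a h G) (ht : t ∈ T) (hy : y ∈ V)
    (l : Unit ⊕ κ) (u v : Unit) (i : κ) :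
    pd (timeBasis b) l (christoffel (timeBasis b) G (.inl u) (.inr i) (.inl v)) (t, y) = 0 :=
  W.pd_of_const ht hy (fun _ ht _ hy => W.christoffel_inl_inr_inl ht hy u v i) l

theorem pd_christoffel_inr_inl_inl (W : IsWarped T V a h G) (ht : t ∈ T) (hy : y ∈ V)
    (l : Unit ⊕ κ) (k : κ) (u v : Unit) :
    pd (timeBasis b) l (christoffel (timeBasis b) G (.inr k) (.inl u) (.inl v)) (t, y) = 0 :=
  W.pd_of_const ht hy (fun _ ht _ hy => W.christoffel_inr_inl_inl ht hy k u v) l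

theorem pd_time_christoffel_inl_inr_inr (W : IsWarped T V a h G) (ht : t ∈ T) (hy : y ∈ V)
    (u v : Unit) (i j : κ) :
    pd (timeBasis b) (.inl v) (christoffel (timeBasis b) G (.inl u) (.inr i) (.inr j)) (t, y)
      = (deriv a t ^ 2 + a t * deriv (deriv a) t) * h i j y := by
  refine pd_inl W.isOpen_time ht (W.differentiableAt_christoffel ht hy _ _ _)
    (fun s hs => W.christoffel_inl_inr_inr hs hy u i j) ?_ v
  exact (((W.hasDerivAt_scale ht).mul (W.hasDerivAt_deriv ht)).mul_const _).congr_deriv (by ring)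

theorem pd_time_christoffel_inr_inr_inl (W : IsWarped T V a h G) (ht : t ∈ T) (hy : y ∈ V)
    (k j : κ) (u v : Unit) :
    pd (timeBasis b) (.inl v) (christoffel (timeBasis b) G (.inr k) (.inr j) (.inl u)) (t, y)
      = if k = j then deriv (deriv a) t / a t - hubble a t ^ 2 else 0 := by
  refine pd_inl W.isOpen_time ht (W.differentiableAt_christoffel ht hy _ _ _)
    (fun s hs => W.christoffel_inr_inr_inl hs hy k j u) ?_ v
  split_ifs
  · exact W.hasDerivAt_hubble ht
  · exact hasDerivAt_const _ _

theorem pd_space_christoffel_inr_inr_inl (W : IsWarped T V a h G) (ht : t ∈ T) (hy : y ∈ V)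
    (l k j : κ) (u : Unit) :
    pd (timeBasis b) (.inr l) (christoffel (timeBasis b) G (.inr k) (.inr j) (.inl u)) (t, y)
      = 0 := by
  rw [pd_inr W.isOpen_space hy (W.differentiableAt_christoffel ht hy _ _ _)
    (fun z hz => W.christoffel_inr_inr_inl ht hz k j u) l, pd_const]

theorem pd_space_christoffel_inr_inl_inr (W : IsWarped T V a h G) (ht : t ∈ T) (hy : y ∈ V)
    (l k j : κ) (u : Unit) :
    pd (timeBasis b) (.inr l) (christoffel (timeBasis b) G (.inr k) (.inl u) (.inr j)) (t, y)
      = 0 := by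
  rw [pd_inr W.isOpen_space hy (W.differentiableAt_christoffel ht hy _ _ _)
    (fun z hz => W.christoffel_inr_inl_inr ht hz k j u) l, pd_const]

theorem pd_time_christoffel_inr_inr_inr (W : IsWarped T V a h G) (ht : t ∈ T) (hy : y ∈ V)
    (k i j : κ) (u : Unit) :
    pd (timeBasis b) (.inl u) (christoffel (timeBasis b) G (.inr k) (.inr i) (.inr j)) (t, y)
      = 0 :=
  pd_inl W.isOpen_time ht (W.differentiableAt_christoffel ht hy _ _ _)
    (fun _ hs => W.christoffel_inr_inr_inr hs hy k i j) (hasDerivAt_const _ _) u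

theorem pd_space_christoffel_inr_inr_inr (W : IsWarped T V a h G) (ht : t ∈ T) (hy : y ∈ V)
    (l k i j : κ) :
    pd (timeBasis b) (.inr l) (christoffel (timeBasis b) G (.inr k) (.inr i) (.inr j)) (t, y)
      = pd b l (christoffel b h k i j) y :=
  pd_inr W.isOpen_space hy (W.differentiableAt_christoffel ht hy _ _ _)
    (fun _ hz => W.christoffel_inr_inr_inr ht hz k i j) l

theorem ricci_inl_inl (W : IsWarped T V a h G) (ht : t ∈ T) (hy : y ∈ V) (u v : Unit) :
    ricci (timeBasis b) G (.inl u) (.inl v) (t, y) = -timeEigenvalue (Fintype.card κ) a t := by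
  simp only [ricci, riemann, Fintype.sum_sum_type, Finset.univ_unique, Finset.sum_singleton,
    W.christoffel_inl_inl ht hy, W.christoffel_inr_inl_inl ht hy, W.christoffel_inl_inr_inl ht hy,
    W.christoffel_inr_inl_inr ht hy, W.christoffel_inr_inr_inl ht hy,
    W.pd_christoffel_inl_inl ht hy, W.pd_christoffel_inr_inl_inl ht hy,
    W.pd_time_christoffel_inr_inr_inl ht hy]
  simp [timeEigenvalue]
  ring

theorem ricci_inl_inr (W : IsWarped T V a h G) (ht : t ∈ T) (hy : y ∈ V) (u : Unit) (j : κ) :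
    ricci (timeBasis b) G (.inl u) (.inr j) (t, y) = 0 := by
  have hs := fun k i j => christoffel_symm (b := b) W.isOpen_space hy W.symm k i j
  simp only [ricci, riemann, Fintype.sum_sum_type, Finset.univ_unique, Finset.sum_singleton,
    W.christoffel_inl_inl ht hy, W.christoffel_inr_inl_inl ht hy, W.christoffel_inl_inr_inl ht hy,
    W.christoffel_inr_inr_inl ht hy,
    W.christoffel_inr_inr_inr ht hy, W.pd_christoffel_inl_inr_inl ht hy,
    W.pd_christoffel_inl_inl ht hy,
    W.pd_space_christoffel_inr_inr_inl ht hy]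
  -- What is left is H times the difference of the contractions Γ^m_{mj} and Γ^m_{jm} of the fibre
  -- connection.
  simp [hs _ _ j]

theorem ricci_inr_inl (W : IsWarped T V a h G) (ht : t ∈ T) (hy : y ∈ V) (u : Unit) (j : κ) :
    ricci (timeBasis b) G (.inr j) (.inl u) (t, y) = 0 := by
  simp only [ricci, riemann, Fintype.sum_sum_type, Finset.univ_unique, Finset.sum_singleton,
    W.christoffel_inl_inl ht hy, W.christoffel_inr_inl_inl ht hy,
    W.christoffel_inr_inl_inr ht hy, W.christoffel_inr_inr_inl ht hy,
    W.christoffel_inr_inr_inr ht hy,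
    W.pd_christoffel_inl_inl ht hy,
    W.pd_space_christoffel_inr_inl_inr ht hy, W.pd_time_christoffel_inr_inr_inr ht hy]
  simp [mul_comm]

theorem ricci_inr_inr (W : IsWarped T V a h G) (ht : t ∈ T) (hy : y ∈ V) (i j : κ) :
    ricci (timeBasis b) G (.inr i) (.inr j) (t, y)
      = ricci b h i j y + ricciFactor (Fintype.card κ) a t * h i j y := by
  have ha := W.scale_ne_zero t ht
  simp only [ricci, riemann, Fintype.sum_sum_type, Finset.univ_unique, Finset.sum_singleton,
    W.christoffel_inl_inl ht hy, W.christoffel_inl_inr_inl ht hy,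
    W.christoffel_inl_inr_inr ht hy,
    W.christoffel_inr_inl_inr ht hy, W.christoffel_inr_inr_inl ht hy,
    W.christoffel_inr_inr_inr ht hy,
    W.pd_christoffel_inl_inl ht hy, W.pd_time_christoffel_inl_inr_inr ht hy,
    W.pd_space_christoffel_inr_inr_inr ht hy]
  simp only [Finset.sum_add_distrib, Finset.sum_sub_distrib]
  simp [W.symm y hy i j, ricciFactor, hubble]
  field_simp
  ring

theorem scalarCurv_eq (W : IsWarped T V a h G) (ht : t ∈ T) (hy : y ∈ V) :
    scalarCurv (timeBasis b) G (t, y) = timeEigenvalue (Fintype.card κ) a t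
      + (Fintype.card κ * ricciFactor (Fintype.card κ) a t + scalarCurv b h y) / a t ^ 2 := by
  have htr : ∑ k, ∑ l, invMetric h k l y * h k l y = Fintype.card κ := by
    simp [W.sum_invMetric_mul hy]
  simp only [scalarCurv, Fintype.sum_sum_type, Finset.univ_unique, Finset.sum_singleton,
    W.invMetric_inl_inl ht hy, W.invMetric_inr_inl ht hy, W.invMetric_inl_inr ht hy,
    W.invMetric_inr_inr ht hy, W.ricci_inl_inl ht hy, W.ricci_inr_inr ht hy, zero_mul,
    Finset.sum_const_zero, add_zero, zero_add]
  have : ∑ k, ∑ l, (a t ^ 2)⁻¹ * invMetric h k l y *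
      (ricci b h k l y + ricciFactor (Fintype.card κ) a t * h k l y)
      = (a t ^ 2)⁻¹ * (scalarCurv b h y + ricciFactor (Fintype.card κ) a t *
        ∑ k, ∑ l, invMetric h k l y * h k l y) := by
    simp only [scalarCurv, Finset.mul_sum, ← Finset.sum_add_distrib]
    refine Finset.sum_congr rfl fun k _ => Finset.sum_congr rfl fun l _ => ?_
    ring
  rw [this, htr]
  simp only [scalarCurv]
  ring

theorem differentiableAt_ricci (W : IsWarped T V a h G) (ht : t ∈ T) (hy : y ∈ V)
    (i j : Unit ⊕ κ) : DifferentiableAt ℝ (ricci (timeBasis b) G i j) (t, y) :=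
  W.differentiableAt ht hy
    (contDiffOn_ricci W.isOpen W.contDiffOn W.det_ne_zero_warped i j)

theorem differentiableAt_ricci_space (W : IsWarped T V a h G) (hy : y ∈ V)
    (i j : κ) : DifferentiableAt ℝ (ricci b h i j) y :=
  W.differentiableAt_space hy
    (contDiffOn_ricci W.isOpen_space W.smooth_metric W.det_ne_zero i j)

theorem differentiableAt_scalarCurv_space (W : IsWarped T V a h G) (hy : y ∈ V) :
    DifferentiableAt ℝ (scalarCurv b h) y :=
  W.differentiableAt_space hy
    (contDiffOn_scalarCurv W.isOpen_space W.smooth_metric W.det_ne_zero)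

theorem differentiableAt_scalarCurv (W : IsWarped T V a h G) (ht : t ∈ T) (hy : y ∈ V) :
    DifferentiableAt ℝ (scalarCurv (timeBasis b) G) (t, y) :=
  W.differentiableAt ht hy
    (contDiffOn_scalarCurv W.isOpen W.contDiffOn W.det_ne_zero_warped)

theorem pd_time_scalarCurv (W : IsWarped T V a h G) (ht : t ∈ T) (hy : y ∈ V) (u : Unit) :
    pd (timeBasis b) (.inl u) (scalarCurv (timeBasis b) G) (t, y)
      = deriv (timeEigenvalue (Fintype.card κ) a) t
        + (Fintype.card κ * (deriv (ricciFactor (Fintype.card κ) a) t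
            - 2 * hubble a t * ricciFactor (Fintype.card κ) a t)
          - 2 * hubble a t * scalarCurv b h y) / a t ^ 2 := by
  have ha := W.scale_ne_zero t ht
  refine pd_inl W.isOpen_time ht (W.differentiableAt_scalarCurv ht hy)
    (fun s hs => W.scalarCurv_eq hs hy) ?_ u
  refine ((W.hasDerivAt_timeEigenvalue ht _).differentiableAt.hasDerivAt.add
    ((((W.hasDerivAt_ricciFactor ht _).differentiableAt.hasDerivAt.const_mul _).add_const _).div
      ((W.hasDerivAt_scale ht).pow 2) (pow_ne_zero 2 ha))).congr_deriv ?_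
  simp only [hubble, Pi.pow_apply]
  push_cast
  field_simp
  ring

theorem pd_space_scalarCurv (W : IsWarped T V a h G) (ht : t ∈ T) (hy : y ∈ V) (i : κ) :
    pd (timeBasis b) (.inr i) (scalarCurv (timeBasis b) G) (t, y)
      = (a t ^ 2)⁻¹ * pd b i (scalarCurv b h) y := by
  have hs := W.differentiableAt_scalarCurv_space (b := b) hy
  rw [pd_inr W.isOpen_space hy (W.differentiableAt_scalarCurv ht hy)
    (ψ := fun z => (timeEigenvalue (Fintype.card κ) a t
      + Fintype.card κ * ricciFactor (Fintype.card κ) a t / a t ^ 2)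
        + (a t ^ 2)⁻¹ * scalarCurv b h z)
    (fun z hz => by rw [W.scalarCurv_eq ht hz]; ring) i,
    pd_add (differentiableAt_const _) (hs.const_mul _), pd_const, pd_const_mul _ hs, zero_add]

theorem nablaRicci_time_inl_inl (W : IsWarped T V a h G) (ht : t ∈ T) (hy : y ∈ V)
    (u v w : Unit) : nablaRicci (timeBasis b) G (.inl u) (.inl v) (.inl w) (t, y)
      = -deriv (timeEigenvalue (Fintype.card κ) a) t := by
  simp only [nablaRicci, Fintype.sum_sum_type, W.christoffel_inl_inl ht hy,
    W.christoffel_inr_inl_inl ht hy, zero_mul, Finset.sum_const_zero, add_zero, sub_zero]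
  exact pd_inl W.isOpen_time ht (W.differentiableAt_ricci ht hy _ _)
    (fun s hs => W.ricci_inl_inl hs hy v w)
    (W.hasDerivAt_timeEigenvalue ht _).differentiableAt.hasDerivAt.neg u

theorem nablaRicci_time_inl_inr (W : IsWarped T V a h G) (ht : t ∈ T) (hy : y ∈ V)
    (u v : Unit) (j : κ) :
    nablaRicci (timeBasis b) G (.inl u) (.inl v) (.inr j) (t, y) = 0 := by
  simp [nablaRicci, Fintype.sum_sum_type, W.christoffel_inl_inl ht hy,
    W.christoffel_inr_inl_inl ht hy, W.ricci_inl_inr ht hy,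
    W.pd_of_const ht hy (fun _ ht _ hy => W.ricci_inl_inr ht hy v j)]

theorem nablaRicci_time_inr_inl (W : IsWarped T V a h G) (ht : t ∈ T) (hy : y ∈ V)
    (u v : Unit) (j : κ) :
    nablaRicci (timeBasis b) G (.inl u) (.inr j) (.inl v) (t, y) = 0 := by
  simp [nablaRicci, Fintype.sum_sum_type, W.christoffel_inl_inl ht hy,
    W.christoffel_inr_inl_inl ht hy, W.ricci_inr_inl ht hy,
    W.pd_of_const ht hy (fun _ ht _ hy => W.ricci_inr_inl ht hy v j)]

theorem nablaRicci_time_inr_inr (W : IsWarped T V a h G) (ht : t ∈ T) (hy : y ∈ V)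
    (u : Unit) (i j : κ) :
    nablaRicci (timeBasis b) G (.inl u) (.inr i) (.inr j) (t, y)
      = deriv (ricciFactor (Fintype.card κ) a) t * h i j y
        - 2 * hubble a t * (ricci b h i j y + ricciFactor (Fintype.card κ) a t * h i j y) := by
  have h1 : pd (timeBasis b) (.inl u) (ricci (timeBasis b) G (.inr i) (.inr j)) (t, y)
      = deriv (ricciFactor (Fintype.card κ) a) t * h i j y :=
    pd_inl W.isOpen_time ht (W.differentiableAt_ricci ht hy _ _)
      (fun s hs => W.ricci_inr_inr hs hy i j)
      (((W.hasDerivAt_ricciFactor ht _).differentiableAt.hasDerivAt.mul_const _).const_add _) u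
  simp only [nablaRicci, Fintype.sum_sum_type, W.christoffel_inl_inl ht hy,
    W.christoffel_inr_inl_inr ht hy, W.ricci_inr_inr ht hy, h1]
  simp
  ring

theorem nablaRicci_space_inl_inl (W : IsWarped T V a h G) (ht : t ∈ T) (hy : y ∈ V)
    (l : κ) (u v : Unit) :
    nablaRicci (timeBasis b) G (.inr l) (.inl u) (.inl v) (t, y) = 0 := by
  have h1 : pd (timeBasis b) (.inr l) (ricci (timeBasis b) G (.inl u) (.inl v)) (t, y) = 0 := by
    rw [pd_inr W.isOpen_space hy (W.differentiableAt_ricci ht hy _ _)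
      (fun z hz => W.ricci_inl_inl ht hz u v) l, pd_const]
  simp [nablaRicci, Fintype.sum_sum_type, W.christoffel_inl_inr_inl ht hy,
    W.ricci_inl_inr ht hy, W.ricci_inr_inl ht hy, h1]

/-- R_tj vanishes identically, but its covariant derivative does not: Γ^t_{lj} picks up R_tt and
Γ^m_{lt} = H δ^m_l picks up R_lj. -/
theorem nablaRicci_space_inl_inr (W : IsWarped T V a h G) (ht : t ∈ T) (hy : y ∈ V)
    (l j : κ) (u : Unit) :
    nablaRicci (timeBasis b) G (.inr l) (.inl u) (.inr j) (t, y)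
      = a t * deriv a t * timeEigenvalue (Fintype.card κ) a t * h l j y
        - hubble a t * (ricci b h l j y + ricciFactor (Fintype.card κ) a t * h l j y) := by
  simp only [nablaRicci, Fintype.sum_sum_type,
    W.pd_of_const ht hy (fun _ ht _ hy => W.ricci_inl_inr ht hy u j),
    W.christoffel_inl_inr_inl ht hy, W.christoffel_inl_inr_inr ht hy,
    W.christoffel_inr_inr_inl ht hy, W.ricci_inl_inl ht hy, W.ricci_inl_inr ht hy,
    W.ricci_inr_inr ht hy]
  simp
  ring

theorem nablaRicci_space_inr_inl (W : IsWarped T V a h G) (ht : t ∈ T) (hy : y ∈ V)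
    (l i : κ) (u : Unit) :
    nablaRicci (timeBasis b) G (.inr l) (.inr i) (.inl u) (t, y)
      = a t * deriv a t * timeEigenvalue (Fintype.card κ) a t * h l i y
        - hubble a t * (ricci b h i l y + ricciFactor (Fintype.card κ) a t * h l i y) := by
  simp only [nablaRicci, Fintype.sum_sum_type,
    W.pd_of_const ht hy (fun _ ht _ hy => W.ricci_inr_inl ht hy u i),
    W.christoffel_inl_inr_inl ht hy, W.christoffel_inl_inr_inr ht hy,
    W.christoffel_inr_inr_inl ht hy, W.ricci_inl_inl ht hy, W.ricci_inr_inl ht hy,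
    W.ricci_inr_inr ht hy]
  simp [W.symm y hy i l]
  ring

/-- Time indices drop out because the mixed components of the Ricci tensor vanish. The bracket is
the covariant derivative of the fibre metric, which is zero by `pd_metric_space`. -/
theorem nablaRicci_space_inr_inr (W : IsWarped T V a h G) (ht : t ∈ T) (hy : y ∈ V)
    (l i j : κ) :
    nablaRicci (timeBasis b) G (.inr l) (.inr i) (.inr j) (t, y) = nablaRicci b h l i j y
      + ricciFactor (Fintype.card κ) a t * (pd b l (h i j) y
        - ∑ m, christoffel b h m l i y * h m j y - ∑ m, christoffel b h m l j y * h i m y) := by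
  have hd := W.differentiableAt_space hy (W.smooth_metric i j)
  have h1 : pd (timeBasis b) (.inr l) (ricci (timeBasis b) G (.inr i) (.inr j)) (t, y)
      = pd b l (ricci b h i j) y + ricciFactor (Fintype.card κ) a t * pd b l (h i j) y := by
    rw [pd_inr W.isOpen_space hy (W.differentiableAt_ricci ht hy _ _)
      (fun z hz => W.ricci_inr_inr ht hz i j) l,
      pd_add (W.differentiableAt_ricci_space hy _ _) (hd.const_mul _), pd_const_mul _ hd]
  simp only [nablaRicci, Fintype.sum_sum_type, h1, W.ricci_inl_inr ht hy, W.ricci_inr_inl ht hy,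
    W.ricci_inr_inr ht hy, W.christoffel_inr_inr_inr ht hy, mul_zero, Finset.sum_const_zero,
    zero_add, mul_add, mul_sub, Finset.sum_add_distrib, Finset.mul_sum]
  simp only [mul_left_comm]
  ring

theorem pd_metric_space (W : IsWarped T V a h G) (hy : y ∈ V) (l i j : κ) :
    pd b l (h i j) y = ∑ m, christoffel b h m l i y * h m j y
      + ∑ m, christoffel b h m l j y * h i m y := by
  rw [pd_metric W.isOpen_space hy W.symm (W.det_ne_zero y hy), add_comm]
  congr 1
  exact Finset.sum_congr rfl fun m _ => mul_comm _ _

end IsWarped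
end WarpedCurvature

/-! ### The curvature conditions for a warped product. -/

section WarpedConditions

/-- Here α, α₁, α₂, α₃ are a and its derivatives, s is the scalar curvature of the fibre and ρ = ∂_t
R. Let P and Q be the left sides, the factors of g* in ∇_t R_ij and ∇_i R_tj. Then `hρ` reads ρ = ξ̇
+ dP/α², and P - 2Q = α²ξ̇/d identically; substituting ξ̇ = 2ρ/(d+3) gives both values. -/
theorem warped_identities {d α : ℝ} (hα : α ≠ 0) (hd : d ≠ 0) (hd' : d + 3 ≠ 0)
    (α₁ α₂ α₃ s ρ : ℝ) (hξ : (d + 3) * (d * (α₃ / α - α₂ * α₁ / α ^ 2)) = 2 * ρ)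
    (hρ : ρ = d * (α₃ / α - α₂ * α₁ / α ^ 2) + (d * ((2 * d - 1) * α₁ * α₂ + α * α₃
      - 2 * (α₁ / α) * ((d - 1) * α₁ ^ 2 + α * α₂)) - 2 * (α₁ / α) * s) / α ^ 2) :
    (2 * d - 1) * α₁ * α₂ + α * α₃ - 2 * (α₁ / α) * (s / d + ((d - 1) * α₁ ^ 2 + α * α₂))
        = (d + 1) / (d * (d + 3)) * ρ * α ^ 2 ∧
    α * α₁ * (d * α₂ / α) - α₁ / α * (s / d + ((d - 1) * α₁ ^ 2 + α * α₂))
        = (d - 1) / (2 * d * (d + 3)) * ρ * α ^ 2 := by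
  have hρ' : ρ = (d + 3) * (d * (α₃ / α - α₂ * α₁ / α ^ 2)) / 2 := by linarith
  rw [hρ'] at hρ ⊢
  clear hρ' hξ
  field_simp at hρ ⊢
  constructor <;> linear_combination -hρ

/-- In the cyclic sum each r_j g_kl occurs once with the coefficient of a_j and twice with that of
b_j, in total 2/(n+2). -/
theorem conformalKilling_of_sinyukov {ι : Type*} {N : ι → ι → ι → ℝ} {g : ι → ι → ℝ} {r : ι → ℝ}
    {n : ℝ} (hn : n - 1 ≠ 0) (hn' : n + 2 ≠ 0) (hg : ∀ i j, g i j = g j i)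
    (hN : ∀ j k l, N j k l = n / ((n - 1) * (n + 2)) * r j * g k l
      + (n - 2) / (2 * (n - 1) * (n + 2)) * r k * g j l
      + (n - 2) / (2 * (n - 1) * (n + 2)) * r l * g j k) (j k l : ι) :
    N j k l + N k j l + N l k j = 2 * r j / (n + 2) * g k l + 2 * r k / (n + 2) * g j l
      + 2 * r l / (n + 2) * g k j := by
  rw [hN, hN, hN, hg l k, hg l j, hg j k]
  field_simp
  ring

/-- The Einstein factor of the fibre of a warped product whose Ricci tensor is conformal Killing,
in terms of the warping function at a time where it is not stationary. -/
def fibreFactor (d : ℝ) (a : ℝ → ℝ) (t : ℝ) : ℝ :=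
  (deriv (ricciFactor d a) t + 2 * a t * deriv a t * timeEigenvalue d a t
    - a t ^ 2 * deriv (timeEigenvalue d a) t) / (4 * hubble a t) - ricciFactor d a t

namespace IsWarped

variable {κ E : Type*} [Fintype κ] [DecidableEq κ] [NormedAddCommGroup E] [NormedSpace ℝ E]
  {b : Module.Basis κ ℝ E} {T : Set ℝ} {V : Set E} {a : ℝ → ℝ} {h : κ → κ → E → ℝ}
  {G : Unit ⊕ κ → Unit ⊕ κ → ℝ × E → ℝ} {U : Unit ⊕ κ → ℝ × E → ℝ} {t : ℝ} {y : E}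

theorem scalarCurv_of_einstein (W : IsWarped T V a h G) (hy : y ∈ V) {c : ℝ}
    (hc : ∀ i j, ricci b h i j y = c * h i j y) : scalarCurv b h y = c * Fintype.card κ := by
  have htr : ∑ k, ∑ l, invMetric h k l y * h k l y = Fintype.card κ := by
    simp [W.sum_invMetric_mul hy]
  rw [← htr]
  simp only [scalarCurv, hc, Finset.mul_sum]
  exact Finset.sum_congr rfl fun k _ => Finset.sum_congr rfl fun l _ => by ring

theorem eigenvalue_eq (W : IsWarped T V a h G) (hU : ∀ t ∈ T, ∀ y ∈ V, ∀ u, U (.inl u) (t, y) = 1)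
    (hU' : ∀ t ∈ T, ∀ y ∈ V, ∀ i, U (.inr i) (t, y) = 0) (ht : t ∈ T) (hy : y ∈ V) :
    eigenvalue (timeBasis b) G U (t, y) = timeEigenvalue (Fintype.card κ) a t := by
  simp [eigenvalue, hU t ht y hy, hU' t ht y hy, W.ricci_inl_inl ht hy]

theorem ricci_eigenvector (W : IsWarped T V a h G)
    (hU : ∀ t ∈ T, ∀ y ∈ V, ∀ u, U (.inl u) (t, y) = 1)
    (hU' : ∀ t ∈ T, ∀ y ∈ V, ∀ i, U (.inr i) (t, y) = 0) (ht : t ∈ T) (hy : y ∈ V)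
    (k : Unit ⊕ κ) : ∑ l, ricci (timeBasis b) G k l (t, y) * U l (t, y)
      = eigenvalue (timeBasis b) G U (t, y) * lower G U k (t, y) := by
  rw [W.eigenvalue_eq hU hU' ht hy]
  rcases k with k | k
  · simp [lower, hU t ht y hy, hU' t ht y hy, W.ricci_inl_inl ht hy, W.inl_inl t ht y hy]
  · simp [lower, hU t ht y hy, hU' t ht y hy, W.ricci_inr_inl ht hy, W.inr_inl t ht y hy]

theorem dirDeriv_eq {f : ℝ × E → ℝ} (hU : U (.inl ()) (t, y) = 1)
    (hU' : ∀ i, U (.inr i) (t, y) = 0) :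
    dirDeriv (timeBasis b) U f (t, y) = pd (timeBasis b) (.inl ()) f (t, y) := by
  simp [dirDeriv, hU, hU']

theorem dirDeriv_eigenvalue (W : IsWarped T V a h G)
    (hU : ∀ t ∈ T, ∀ y ∈ V, ∀ u, U (.inl u) (t, y) = 1)
    (hU' : ∀ t ∈ T, ∀ y ∈ V, ∀ i, U (.inr i) (t, y) = 0) (ht : t ∈ T) (hy : y ∈ V) :
    dirDeriv (timeBasis b) U (eigenvalue (timeBasis b) G U) (t, y)
      = deriv (timeEigenvalue (Fintype.card κ) a) t := by
  have hd := (W.hasDerivAt_timeEigenvalue ht (Fintype.card κ)).differentiableAt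
  have h1 : DifferentiableAt ℝ (fun p : ℝ × E => timeEigenvalue (Fintype.card κ) a p.1) (t, y) :=
    DifferentiableAt.comp (f := Prod.fst) (t, y) hd differentiableAt_fst
  rw [dirDeriv_eq (hU t ht y hy _) (hU' t ht y hy),
    pd_congr W.isOpen (Set.mk_mem_prod ht hy)
      (f' := fun p => timeEigenvalue (Fintype.card κ) a p.1)
      (fun p hp => W.eigenvalue_eq hU hU' hp.1 hp.2)]
  exact pd_inl W.isOpen_time ht h1 (fun s _ => rfl) hd.hasDerivAt _

/-- In a warped product with spatial dimension at least three and Einstein fibre, the eigenvalue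
equation forces the gradient of the Ricci tensor to be pure trace. -/
theorem nablaRicci_of_einstein (W : IsWarped T V a h G) (hκ : 3 ≤ Fintype.card κ)
    (hE : ∀ z ∈ V, ∀ i j, ricci b h i j z = scalarCurv b h z / Fintype.card κ * h i j z)
    (ht : t ∈ T) (hy : y ∈ V)
    (hξ : (Fintype.card κ + 3 : ℝ) * deriv (timeEigenvalue (Fintype.card κ) a) t
      = 2 * pd (timeBasis b) (.inl ()) (scalarCurv (timeBasis b) G) (t, y)) (j k l : Unit ⊕ κ) :
    let r := fun i => pd (timeBasis b) i (scalarCurv (timeBasis b) G) (t, y)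
    let n : ℝ := Fintype.card (Unit ⊕ κ)
    let α := fun i => n / ((n - 1) * (n + 2)) * r i
    let β := fun i => (n - 2) / (2 * (n - 1) * (n + 2)) * r i
    nablaRicci (timeBasis b) G j k l (t, y)
      = α j * G k l (t, y) + β k * G j l (t, y) + β l * G j k (t, y) := by
  intro r n α β
  have ha := W.scale_ne_zero t ht
  have hn : n = Fintype.card κ + 1 := by simp [n, add_comm]
  have hd3 : (3 : ℝ) ≤ Fintype.card κ := by exact_mod_cast hκ
  have hcard : Fintype.card κ ≠ 2 := by omega
  -- The Einstein factor s/d of the fibre is locally constant, as the fibre has dimension at least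
  -- three.
  have hsd := fun i => schur (b := b) W.isOpen_space hy W.smooth_metric W.symm W.det_ne_zero hcard
    hE i
  have hsdiff := W.differentiableAt_scalarCurv_space (b := b) hy
  have hrt := W.pd_time_scalarCurv (b := b) ht hy ()
  have hF := (W.hasDerivAt_ricciFactor ht (Fintype.card κ)).deriv
  have hx := (W.hasDerivAt_timeEigenvalue ht (Fintype.card κ)).deriv
  have hspace : ∀ i : κ, r (.inr i) = 0 := by
    intro i
    have h1 : pd b i (fun z => (Fintype.card κ : ℝ)⁻¹ * scalarCurv b h z) y = 0 := by
      rw [← hsd i]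
      congr 1
      funext z
      ring
    rw [pd_const_mul _ hsdiff] at h1
    have h2 : pd b i (scalarCurv b h) y = 0 := by
      refine (mul_eq_zero.1 h1).resolve_left (inv_ne_zero ?_)
      positivity
    simp [r, W.pd_space_scalarCurv ht hy, h2]
  -- R* is a locally constant multiple of the parallel tensor g*.
  have hnab : ∀ l i j, nablaRicci b h l i j y = 0 := by
    intro l i j
    have h1 : pd b l (ricci b h i j) y
        = scalarCurv b h y / Fintype.card κ * pd b l (h i j) y := by
      have hm := pd_mul (b := b) (f := fun z => scalarCurv b h z / Fintype.card κ) (f' := h i j)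
        (by fun_prop) (W.differentiableAt_space hy (W.smooth_metric i j)) l
      rw [pd_congr W.isOpen_space hy (fun z hz => hE z hz i j), hm, hsd]
      ring
    simp only [nablaRicci, h1, hE y hy]
    rw [W.pd_metric_space hy l i j, mul_add, Finset.mul_sum, Finset.mul_sum]
    simp only [mul_left_comm _ (scalarCurv b h y / (Fintype.card κ : ℝ))]
    ring
  have hr : r (.inl ()) = pd (timeBasis b) (.inl ()) (scalarCurv (timeBasis b) G) (t, y) := rfl
  rw [← hr] at hξ hrt
  have hd0 : (Fintype.card κ : ℝ) ≠ 0 := by linarith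
  have hd3' : (Fintype.card κ : ℝ) + 3 ≠ 0 := by linarith
  have hn1 : n - 1 = Fintype.card κ := by rw [hn]; ring
  have hn2 : n + 2 = Fintype.card κ + 3 := by rw [hn]; ring
  obtain ⟨key1, key2⟩ := warped_identities (d := Fintype.card κ) ha hd0 hd3' (deriv a t)
    (deriv (deriv a) t) (deriv (deriv (deriv a)) t) (scalarCurv b h y) (r (.inl ()))
    (by rw [← hx]; exact hξ) (by rw [← hx, ← hF]; exact hrt)
  rw [← hF] at key1
  change _ - 2 * hubble a t * (_ + ricciFactor _ a t) = _ at key1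
  change _ * timeEigenvalue _ a t - hubble a t * (_ + ricciFactor _ a t) = _ at key2
  have hα : α (.inl ()) = (Fintype.card κ + 1) / (Fintype.card κ * (Fintype.card κ + 3))
      * r (.inl ()) := by
    simp only [α, hn1, hn2]
    rw [hn]
  have hβ : β (.inl ()) = (Fintype.card κ - 1) / (2 * Fintype.card κ * (Fintype.card κ + 3))
      * r (.inl ()) := by
    simp only [β, hn1, hn2]
    rw [hn]
    ring
  have hα' : ∀ i, α (.inr i) = 0 := fun i => by simp [α, hspace]
  have hβ' : ∀ i, β (.inr i) = 0 := fun i => by simp [β, hspace]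
  rcases j with ⟨⟩ | j <;> rcases k with ⟨⟩ | k <;> rcases l with ⟨⟩ | l
  · rw [W.nablaRicci_time_inl_inl ht hy, W.inl_inl t ht y hy, hα, hβ]
    -- The three coefficients on the right of the ttt-component add up to 2/(n+2), so this component
    -- is exactly the eigenvalue equation.
    have hξ' : deriv (timeEigenvalue (Fintype.card κ) a) t
        = 2 * r (.inl ()) / (Fintype.card κ + 3) := by
      rw [eq_div_iff hd3']
      linarith
    rw [hξ']
    field_simp
    ring
  · rw [W.nablaRicci_time_inl_inr ht hy, W.inl_inr t ht y hy, hβ']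
    ring
  · rw [W.nablaRicci_time_inr_inl ht hy, W.inr_inl t ht y hy, W.inl_inr t ht y hy, hβ']
    ring
  · rw [W.nablaRicci_time_inr_inr ht hy, W.inr_inr t ht y hy, hβ', hβ', hα, hE y hy]
    linear_combination h k l y * key1
  · rw [W.nablaRicci_space_inl_inl ht hy, W.inr_inl t ht y hy, hα']
    ring
  · rw [W.nablaRicci_space_inl_inr ht hy, W.inr_inr t ht y hy, hα', hβ', hβ, hE y hy]
    linear_combination h j l y * key2
  · rw [W.nablaRicci_space_inr_inl ht hy, W.inr_inr t ht y hy, hα', hβ', hβ, hE y hy,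
      W.symm y hy k j]
    linear_combination h j k y * key2
  · rw [W.nablaRicci_space_inr_inr ht hy, hα', hβ', hβ', hnab, W.pd_metric_space hy j k l]
    ring

/-- This is the ttt-component: three equal terms on each side, and g_tt = -1. -/
theorem eigenvalue_equation_of_conformalKilling (W : IsWarped T V a h G) (ht : t ∈ T) (hy : y ∈ V)
    {n : ℝ} (hn : n = Fintype.card κ + 1)
    (hCK : ∀ j k l, nablaRicci (timeBasis b) G j k l (t, y) + nablaRicci (timeBasis b) G k j l (t, y)
        + nablaRicci (timeBasis b) G l k j (t, y)
      = 2 * pd (timeBasis b) j (scalarCurv (timeBasis b) G) (t, y) / (n + 2) * G k l (t, y)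
        + 2 * pd (timeBasis b) k (scalarCurv (timeBasis b) G) (t, y) / (n + 2) * G j l (t, y)
        + 2 * pd (timeBasis b) l (scalarCurv (timeBasis b) G) (t, y) / (n + 2) * G k j (t, y)) :
    (Fintype.card κ + 3 : ℝ) * deriv (timeEigenvalue (Fintype.card κ) a) t
      = 2 * pd (timeBasis b) (.inl ()) (scalarCurv (timeBasis b) G) (t, y) := by
  have h0 := hCK (.inl ()) (.inl ()) (.inl ())
  have hn2 : n + 2 = Fintype.card κ + 3 := by rw [hn]; ring
  have : (Fintype.card κ + 3 : ℝ) ≠ 0 := by positivity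
  rw [W.nablaRicci_time_inl_inl ht hy, W.inl_inl t ht y hy, hn2] at h0
  field_simp at h0
  linarith

theorem ricci_of_conformalKilling (W : IsWarped T V a h G) (ht : t ∈ T) (hy : y ∈ V)
    (hat : deriv a t ≠ 0) {n : ℝ} (hn : n = Fintype.card κ + 1)
    (hCK : ∀ j k l, nablaRicci (timeBasis b) G j k l (t, y) + nablaRicci (timeBasis b) G k j l (t, y)
        + nablaRicci (timeBasis b) G l k j (t, y)
      = 2 * pd (timeBasis b) j (scalarCurv (timeBasis b) G) (t, y) / (n + 2) * G k l (t, y)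
        + 2 * pd (timeBasis b) k (scalarCurv (timeBasis b) G) (t, y) / (n + 2) * G j l (t, y)
        + 2 * pd (timeBasis b) l (scalarCurv (timeBasis b) G) (t, y) / (n + 2) * G k j (t, y))
    (i j : κ) : ricci b h i j y = fibreFactor (Fintype.card κ) a t * h i j y := by
  have hEE := W.eigenvalue_equation_of_conformalKilling ht hy hn hCK
  -- This component reads Ḟg* - 4H(R* + Fg*) + 2aȧξg* = 2∂_tR/(n+2) · a²g*. The eigenvalue equation
  -- turns the right side into a²ξ̇g*, and division by 4H yields `fibreFactor`.
  have h0 := hCK (.inl ()) (.inr i) (.inr j)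
  have hn2 : n + 2 = Fintype.card κ + 3 := by rw [hn]; ring
  have hd : (Fintype.card κ + 3 : ℝ) ≠ 0 := by positivity
  have hH : hubble a t ≠ 0 := div_ne_zero hat (W.scale_ne_zero t ht)
  rw [W.nablaRicci_time_inr_inr ht hy, W.nablaRicci_space_inl_inr ht hy,
    W.nablaRicci_space_inr_inl ht hy, W.inr_inr t ht y hy, W.inl_inr t ht y hy,
    W.inr_inl t ht y hy, hn2, ← hEE, W.symm y hy j i] at h0
  unfold fibreFactor
  field_simp
  field_simp at h0
  refine mul_left_cancel₀ hd ?_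
  linear_combination -h0

/-- If the Ricci tensor of a warped product has the perfect-fluid form at a point, with a vector that
is not purely spatial, then the fibre is Einstein at that point. -/
theorem ricci_of_perfectFluid (W : IsWarped T V a h G) (ht : t ∈ T) (hy : y ∈ V) {A B : ℝ}
    {w : Unit ⊕ κ → ℝ} (hw : w (.inl ()) ≠ 0)
    (hPF : ∀ k l, ricci (timeBasis b) G k l (t, y) = A * G k l (t, y) + B * w k * w l) (i j : κ) :
    ricci b h i j y = scalarCurv b h y / Fintype.card κ * h i j y := by
  -- R_it and g_it both vanish, leaving B w_i w_t = 0.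
  have h1 : ∀ i, B * w (.inr i) = 0 := by
    intro i
    have h0 := hPF (.inr i) (.inl ())
    rw [W.ricci_inr_inl ht hy, W.inr_inl t ht y hy, mul_zero, zero_add] at h0
    exact (mul_eq_zero.1 h0.symm).resolve_right hw
  have h2 : ∀ i j, ricci b h i j y
      = (A * a t ^ 2 - ricciFactor (Fintype.card κ) a t) * h i j y := by
    intro i j
    have h0 := hPF (.inr i) (.inr j)
    rw [W.ricci_inr_inr ht hy, W.inr_inr t ht y hy, h1] at h0
    linear_combination h0
  -- Taking the trace identifies the factor with s/d, a form free of A and B to which Schur's lemma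
  -- applies.
  have : Nonempty κ := ⟨i⟩
  have hd : (Fintype.card κ : ℝ) ≠ 0 := by exact_mod_cast Fintype.card_ne_zero
  rw [W.scalarCurv_of_einstein hy h2, mul_div_cancel_right₀ _ hd]
  exact h2 i j

/-- The spatial block dictates A = (c + F)/a², and R_tt = -ξ = -A + B then dictates B = A - ξ. -/
theorem ricci_eq_perfectFluid (W : IsWarped T V a h G) (ht : t ∈ T) (hy : y ∈ V) {c : ℝ}
    (hc : ∀ i j, ricci b h i j y = c * h i j y)
    (hU : U (.inl ()) (t, y) = 1) (hU' : ∀ i, U (.inr i) (t, y) = 0) (k l : Unit ⊕ κ) :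
    ricci (timeBasis b) G k l (t, y)
      = (c + ricciFactor (Fintype.card κ) a t) / a t ^ 2 * G k l (t, y)
        + ((c + ricciFactor (Fintype.card κ) a t) / a t ^ 2 - timeEigenvalue (Fintype.card κ) a t)
          * lower G U k (t, y) * lower G U l (t, y) := by
  have ha := W.scale_ne_zero t ht
  have hl : ∀ u, lower G U (.inl u) (t, y) = -1 := fun u => by
    simp [lower, hU, hU', W.inl_inl t ht y hy]
  have hl' : ∀ i, lower G U (.inr i) (t, y) = 0 := fun i => by
    simp [lower, hU, hU', W.inr_inl t ht y hy]
  rcases k with k | k <;> rcases l with l | l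
  · rw [W.ricci_inl_inl ht hy, hl, W.inl_inl t ht y hy]
    ring
  · rw [W.ricci_inl_inr ht hy, hl, hl', W.inl_inr t ht y hy]
    ring
  · rw [W.ricci_inr_inl ht hy, hl, hl', W.inr_inl t ht y hy]
    ring
  · rw [W.ricci_inr_inr ht hy, hl', hl', W.inr_inr t ht y hy, hc]
    field_simp
    ring

end IsWarped
end WarpedConditions

/-! ### Charts of the time interval. -/

section TimeChart

variable {T : TopologicalSpace.Opens ℝ} {e₁ : OpenPartialHomeomorph T ℝ}

/-- The line has only the identity chart, so every chart of T is its restriction, that is, the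
inclusion into ℝ. The atlas is indexed by points of T, which is why a chart brings non-emptiness
with it. -/
theorem timeChart_eq (he₁ : e₁ ∈ atlas ℝ T) :
    ∃ hT : Nonempty T, e₁ = (OpenPartialHomeomorph.refl ℝ).subtypeRestr hT := by
  obtain ⟨x, hx⟩ : ∃ x : T, e₁ = (chartAt ℝ (x : ℝ)).subtypeRestr ⟨x⟩ := by
    simpa [atlas, ChartedSpace.atlas, eq_comm] using he₁
  exact ⟨⟨x⟩, hx⟩

theorem timeChart_apply (he₁ : e₁ ∈ atlas ℝ T) (t : T) : e₁ t = t := by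
  obtain ⟨hT, rfl⟩ := timeChart_eq he₁
  rfl

theorem timeChart_source (he₁ : e₁ ∈ atlas ℝ T) : e₁.source = Set.univ := by
  obtain ⟨hT, rfl⟩ := timeChart_eq he₁
  simp

theorem timeChart_target (he₁ : e₁ ∈ atlas ℝ T) : e₁.target = T := by
  rw [← e₁.image_source_eq_target, timeChart_source he₁]
  ext t
  simp only [Set.image_univ, Set.mem_range, timeChart_apply he₁]
  simp

theorem timeChart_symm_apply (he₁ : e₁ ∈ atlas ℝ T) {t : ℝ} (ht : t ∈ T) :
    (e₁.symm t : ℝ) = t := by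
  have h := e₁.right_inv (x := t) (by rw [timeChart_target he₁]; exact ht)
  rwa [timeChart_apply he₁] at h

theorem hasMFDerivAt_subtype_val (p : T) :
    HasMFDerivAt 𝓘(ℝ, ℝ) 𝓘(ℝ, ℝ) (Subtype.val : T → ℝ) p (ContinuousLinearMap.id ℝ ℝ) := by
  refine ⟨continuous_subtype_val.continuousAt, ?_⟩
  have hp := chart_mem_atlas ℝ p
  refine HasFDerivAt.hasFDerivWithinAt ?_
  have h0 : extChartAt 𝓘(ℝ, ℝ) p p = p := timeChart_apply hp p
  rw [h0]
  refine (hasFDerivAt_id (p : ℝ)).congr_of_eventuallyEq ?_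
  filter_upwards [T.isOpen.mem_nhds p.2] with t ht
  exact timeChart_symm_apply hp ht

/-- Near t, inverting the chart and then including in ℝ is the identity; since the inclusion has
derivative the identity, the chain rule leaves no other choice. -/
theorem hasMFDerivAt_timeChart_symm (he₁ : e₁ ∈ atlas ℝ T) {t : ℝ} (ht : t ∈ T) :
    HasMFDerivAt 𝓘(ℝ, ℝ) 𝓘(ℝ, ℝ) e₁.symm t (ContinuousLinearMap.id ℝ ℝ) := by
  have hd : MDifferentiableAt 𝓘(ℝ, ℝ) 𝓘(ℝ, ℝ) e₁.symm t :=
    mdifferentiableAt_atlas_symm he₁ (by rw [timeChart_target he₁]; exact ht)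
  have h1 := (hasMFDerivAt_subtype_val (e₁.symm t)).comp t hd.hasMFDerivAt
  have h2 : HasMFDerivAt 𝓘(ℝ, ℝ) 𝓘(ℝ, ℝ) (Subtype.val ∘ e₁.symm) t
      (ContinuousLinearMap.id ℝ ℝ) := by
    refine ((hasFDerivAt_id t).congr_of_eventuallyEq ?_).hasMFDerivAt
    filter_upwards [T.isOpen.mem_nhds ht] with s hs
    exact timeChart_symm_apply he₁ hs
  have h3 := hasMFDerivAt_unique h1 h2
  have h4 : mfderiv 𝓘(ℝ, ℝ) 𝓘(ℝ, ℝ) e₁.symm t = ContinuousLinearMap.id ℝ ℝ := h3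
  rw [← h4]
  exact hd.hasMFDerivAt

end TimeChart

/-! ### The warped metric in product charts. -/

section ProductChart

variable {d : ℕ} {N : Type*} [TopologicalSpace N] [ChartedSpace (EuclideanSpace ℝ (Fin d)) N]
  [IsManifold 𝓘(ℝ, EuclideanSpace ℝ (Fin d)) ∞ N] {T : TopologicalSpace.Opens ℝ}
  {e₁ : OpenPartialHomeomorph T ℝ} {e₂ : OpenPartialHomeomorph N (EuclideanSpace ℝ (Fin d))}

theorem mem_productChart_target (he₁ : e₁ ∈ atlas ℝ T) {t : ℝ} {y : EuclideanSpace ℝ (Fin d)} :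
    (t, y) ∈ ((e₁.prod e₂).extend (model d)).target ↔ t ∈ T ∧ y ∈ e₂.target := by
  have h := timeChart_target he₁
  rw [OpenPartialHomeomorph.extend_prod]
  simp [h]

/-- The coordinate vector fields of a chart of `N`. -/
def spaceVector (e₂ : OpenPartialHomeomorph N (EuclideanSpace ℝ (Fin d))) (i : Fin d)
    (y : EuclideanSpace ℝ (Fin d)) : TangentSpace 𝓘(ℝ, EuclideanSpace ℝ (Fin d)) (e₂.symm y) :=
  mfderiv 𝓘(ℝ, EuclideanSpace ℝ (Fin d)) 𝓘(ℝ, EuclideanSpace ℝ (Fin d)) e₂.symm y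
    (EuclideanSpace.basisFun (Fin d) ℝ i)

theorem hasMFDerivAt_productChart_symm (he₁ : e₁ ∈ atlas ℝ T)
    (he₂ : e₂ ∈ atlas (EuclideanSpace ℝ (Fin d)) N) {t : ℝ} {y : EuclideanSpace ℝ (Fin d)}
    (ht : t ∈ T) (hy : y ∈ e₂.target) :
    HasMFDerivAt 𝓘(ℝ, ℝ × EuclideanSpace ℝ (Fin d)) (model d)
      ((e₁.prod e₂).extend (model d)).symm (t, y)
      (((ContinuousLinearMap.id ℝ ℝ).comp
          (ContinuousLinearMap.fst ℝ ℝ (EuclideanSpace ℝ (Fin d)))).prod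
        ((mfderiv 𝓘(ℝ, EuclideanSpace ℝ (Fin d)) 𝓘(ℝ, EuclideanSpace ℝ (Fin d)) e₂.symm y).comp
          (ContinuousLinearMap.snd ℝ ℝ (EuclideanSpace ℝ (Fin d))))) := by
  have : IsManifold 𝓘(ℝ, EuclideanSpace ℝ (Fin d)) 1 N :=
    IsManifold.of_le (n := ∞) (by simp)
  have h1 := (hasMFDerivAt_timeChart_symm he₁ ht).comp (t, y)
    (hasFDerivAt_fst (𝕜 := ℝ) (p := (t, y))).hasMFDerivAt
  have h2 := (mdifferentiableAt_atlas_symm (I := 𝓘(ℝ, EuclideanSpace ℝ (Fin d))) he₂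
    hy).hasMFDerivAt.comp (t, y) (hasFDerivAt_snd (𝕜 := ℝ) (p := (t, y))).hasMFDerivAt
  exact h1.prodMk h2

theorem coordVector_inl (he₁ : e₁ ∈ atlas ℝ T)
    (he₂ : e₂ ∈ atlas (EuclideanSpace ℝ (Fin d)) N) {t : ℝ} {y : EuclideanSpace ℝ (Fin d)}
    (ht : t ∈ T) (hy : y ∈ e₂.target) (u : Unit) :
    coordVector (model d) (stdBasis d) (e₁.prod e₂) (.inl u) (t, y)
      = ((1, 0) : ℝ × EuclideanSpace ℝ (Fin d)) := by
  rw [coordVector, (hasMFDerivAt_productChart_symm he₁ he₂ ht hy).mfderiv]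
  have : stdBasis d (.inl u) = ((1, 0) : ℝ × EuclideanSpace ℝ (Fin d)) := by
    simp [stdBasis, Module.Basis.prod_apply]
  rw [this]
  exact Prod.ext rfl (map_zero (mfderiv 𝓘(ℝ, EuclideanSpace ℝ (Fin d))
    𝓘(ℝ, EuclideanSpace ℝ (Fin d)) e₂.symm y))

theorem coordVector_inr (he₁ : e₁ ∈ atlas ℝ T)
    (he₂ : e₂ ∈ atlas (EuclideanSpace ℝ (Fin d)) N) {t : ℝ} {y : EuclideanSpace ℝ (Fin d)}
    (ht : t ∈ T) (hy : y ∈ e₂.target) (i : Fin d) :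
    coordVector (model d) (stdBasis d) (e₁.prod e₂) (.inr i) (t, y)
      = ((0, spaceVector e₂ i y) : ℝ × EuclideanSpace ℝ (Fin d)) := by
  rw [coordVector, (hasMFDerivAt_productChart_symm he₁ he₂ ht hy).mfderiv]
  have : stdBasis d (.inr i)
      = ((0, EuclideanSpace.basisFun (Fin d) ℝ i) : ℝ × EuclideanSpace ℝ (Fin d)) := by
    simp [stdBasis, Module.Basis.prod_apply]
  rw [this]
  rfl

theorem mdifferentiableAt_productChart (he₁ : e₁ ∈ atlas ℝ T)
    (he₂ : e₂ ∈ atlas (EuclideanSpace ℝ (Fin d)) N) {p : T × N} (hp : p.2 ∈ e₂.source) :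
    MDifferentiableAt (model d) 𝓘(ℝ, ℝ × EuclideanSpace ℝ (Fin d))
      ((e₁.prod e₂).extend (model d)) p := by
  have hm : e₁.prod e₂ ∈ atlas (ModelProd ℝ (EuclideanSpace ℝ (Fin d))) (T × N) :=
    Set.mem_image2_of_mem he₁ he₂
  refine (OpenPartialHomeomorph.contMDiffAt_extend (n := 1)
    (IsManifold.subset_maximalAtlas hm) ?_).mdifferentiableAt one_ne_zero
  simp [timeChart_source he₁, hp]

theorem mfderiv_productChart_fst (he₁ : e₁ ∈ atlas ℝ T)
    (he₂ : e₂ ∈ atlas (EuclideanSpace ℝ (Fin d)) N) {p : T × N} (hp : p.2 ∈ e₂.source)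
    (v : ℝ × EuclideanSpace ℝ (Fin d)) :
    (show ℝ × EuclideanSpace ℝ (Fin d) from mfderiv (model d) 𝓘(ℝ, ℝ × EuclideanSpace ℝ (Fin d))
      ((e₁.prod e₂).extend (model d)) p v).1 = v.1 := by
  have hd := (mdifferentiableAt_productChart he₁ he₂ hp).hasMFDerivAt
  have h1 := (hasFDerivAt_fst (𝕜 := ℝ)
    (p := (e₁.prod e₂).extend (model d) p)).hasMFDerivAt.comp p hd
  have h2 := (hasMFDerivAt_subtype_val p.1).comp p (hasMFDerivAt_fst (I := 𝓘(ℝ, ℝ))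
    (I' := 𝓘(ℝ, EuclideanSpace ℝ (Fin d))) p)
  have h3 : Prod.fst ∘ ((e₁.prod e₂).extend (model d)) = Subtype.val ∘ Prod.fst := by
    funext q
    exact timeChart_apply he₁ q.1
  rw [h3] at h1
  exact DFunLike.congr_fun (hasMFDerivAt_unique h1 h2) v

/-- Spatial components are needed only for ∂_t, whereas `mfderiv_productChart_fst` treats any
vector, because the fluid velocity in (PF) is arbitrary. -/
theorem mfderiv_productChart_snd (he₁ : e₁ ∈ atlas ℝ T)
    (he₂ : e₂ ∈ atlas (EuclideanSpace ℝ (Fin d)) N) {p : T × N} (hp : p.2 ∈ e₂.source) (c : ℝ) :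
    (show ℝ × EuclideanSpace ℝ (Fin d) from mfderiv (model d) 𝓘(ℝ, ℝ × EuclideanSpace ℝ (Fin d))
      ((e₁.prod e₂).extend (model d)) p ((c, 0) : ℝ × EuclideanSpace ℝ (Fin d))).2 = 0 := by
  have : IsManifold 𝓘(ℝ, EuclideanSpace ℝ (Fin d)) 1 N :=
    IsManifold.of_le (n := ∞) (by simp)
  have hd := (mdifferentiableAt_productChart he₁ he₂ hp).hasMFDerivAt
  have h1 := (hasFDerivAt_snd (𝕜 := ℝ)
    (p := (e₁.prod e₂).extend (model d) p)).hasMFDerivAt.comp p hd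
  have h2 := (mdifferentiableAt_atlas (I := 𝓘(ℝ, EuclideanSpace ℝ (Fin d))) he₂
    hp).hasMFDerivAt.comp p (hasMFDerivAt_snd (I := 𝓘(ℝ, ℝ))
    (I' := 𝓘(ℝ, EuclideanSpace ℝ (Fin d))) p)
  have h3 := DFunLike.congr_fun (hasMFDerivAt_unique h1 h2)
    ((c, 0) : ℝ × EuclideanSpace ℝ (Fin d))
  exact h3.trans (map_zero (mfderiv 𝓘(ℝ, EuclideanSpace ℝ (Fin d))
    𝓘(ℝ, EuclideanSpace ℝ (Fin d)) e₂ p.2))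

theorem stdBasis_repr_inl (x : ℝ × EuclideanSpace ℝ (Fin d)) (u : Unit) :
    (stdBasis d).repr x (.inl u) = x.1 := by
  rw [stdBasis, Module.Basis.prod_repr_inl]
  simp

theorem stdBasis_repr_inr (x : ℝ × EuclideanSpace ℝ (Fin d)) (i : Fin d) :
    (stdBasis d).repr x (.inr i) = x.2 i := by
  rw [stdBasis, Module.Basis.prod_repr_inr]
  simp

theorem vectorComp_inl (he₁ : e₁ ∈ atlas ℝ T)
    (he₂ : e₂ ∈ atlas (EuclideanSpace ℝ (Fin d)) N) {t : ℝ} {y : EuclideanSpace ℝ (Fin d)}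
    (hy : y ∈ e₂.target) (v : ∀ p : T × N, TangentSpace (model d) p) (u : Unit) :
    vectorComp (model d) (stdBasis d) v (e₁.prod e₂) (.inl u) (t, y)
      = (show ℝ × EuclideanSpace ℝ (Fin d) from
          v (((e₁.prod e₂).extend (model d)).symm (t, y))).1 := by
  have h := mfderiv_productChart_fst he₁ he₂
    (p := ((e₁.prod e₂).extend (model d)).symm (t, y)) (e₂.map_target hy)
    (v (((e₁.prod e₂).extend (model d)).symm (t, y)))
  exact (stdBasis_repr_inl _ u).trans h

theorem vectorComp_timeVector_inr (he₁ : e₁ ∈ atlas ℝ T)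
    (he₂ : e₂ ∈ atlas (EuclideanSpace ℝ (Fin d)) N) {t : ℝ} {y : EuclideanSpace ℝ (Fin d)}
    (hy : y ∈ e₂.target) (i : Fin d) :
    vectorComp (model d) (stdBasis d) (timeVector (N := N) T) (e₁.prod e₂) (.inr i) (t, y) = 0 := by
  have h := mfderiv_productChart_snd he₁ he₂
    (p := ((e₁.prod e₂).extend (model d)).symm (t, y)) (e₂.map_target hy) 1
  exact (stdBasis_repr_inr _ i).trans
    (congrArg (fun w : EuclideanSpace ℝ (Fin d) => w i) h)

/-- The components in the chart `e₂` of a Riemannian metric on `N`. -/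
def spaceMetric (h : Bundle.ContMDiffRiemannianMetric 𝓘(ℝ, EuclideanSpace ℝ (Fin d)) ∞
      (EuclideanSpace ℝ (Fin d)) (fun y : N => TangentSpace 𝓘(ℝ, EuclideanSpace ℝ (Fin d)) y))
    (e₂ : OpenPartialHomeomorph N (EuclideanSpace ℝ (Fin d))) (i j : Fin d)
    (y : EuclideanSpace ℝ (Fin d)) : ℝ :=
  h.inner (e₂.symm y) (spaceVector e₂ i y) (spaceVector e₂ j y)

variable (h : Bundle.ContMDiffRiemannianMetric 𝓘(ℝ, EuclideanSpace ℝ (Fin d)) ∞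
      (EuclideanSpace ℝ (Fin d)) (fun y : N => TangentSpace 𝓘(ℝ, EuclideanSpace ℝ (Fin d)) y))

/-- The field is the image of a constant field under the tangent map of the inverse chart, which is
smooth. -/
theorem contMDiffOn_spaceVector (he₂ : e₂ ∈ atlas (EuclideanSpace ℝ (Fin d)) N) (i : Fin d) :
    ContMDiffOn 𝓘(ℝ, EuclideanSpace ℝ (Fin d)) 𝓘(ℝ, EuclideanSpace ℝ (Fin d)).tangent ∞
      (fun y => (⟨e₂.symm y, spaceVector e₂ i y⟩ :
        TangentBundle 𝓘(ℝ, EuclideanSpace ℝ (Fin d)) N)) e₂.target := by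
  have hs := contMDiffOn_symm_of_mem_maximalAtlas (I := 𝓘(ℝ, EuclideanSpace ℝ (Fin d))) (n := ∞)
    (IsManifold.subset_maximalAtlas he₂)
  have h1 := hs.contMDiffOn_tangentMapWithin (m := ∞) le_rfl e₂.open_target.uniqueMDiffOn
  have h2 : ContMDiff 𝓘(ℝ, EuclideanSpace ℝ (Fin d)) 𝓘(ℝ, EuclideanSpace ℝ (Fin d)).tangent ∞
      (fun y => (⟨y, EuclideanSpace.basisFun (Fin d) ℝ i⟩ :
        TangentBundle 𝓘(ℝ, EuclideanSpace ℝ (Fin d)) (EuclideanSpace ℝ (Fin d)))) :=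
    contMDiff_vectorSpace_iff_contDiff.2 contDiff_const
  refine (h1.comp h2.contMDiffOn fun y hy => hy).congr fun y hy => ?_
  simp only [Function.comp_apply, tangentMapWithin, mfderivWithin_of_isOpen e₂.open_target hy]
  rfl

theorem contDiffOn_spaceMetric (he₂ : e₂ ∈ atlas (EuclideanSpace ℝ (Fin d)) N) (i j : Fin d) :
    ContDiffOn ℝ ∞ (spaceMetric h e₂ i j) e₂.target := by
  have hs := contMDiffOn_symm_of_mem_maximalAtlas (I := 𝓘(ℝ, EuclideanSpace ℝ (Fin d))) (n := ∞)
    (IsManifold.subset_maximalAtlas he₂)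
  intro y hy
  have h1 : ContMDiffWithinAt 𝓘(ℝ, EuclideanSpace ℝ (Fin d))
      (𝓘(ℝ, EuclideanSpace ℝ (Fin d)).prod 𝓘(ℝ)) ∞
      (fun y => Bundle.TotalSpace.mk' ℝ (E := Bundle.Trivial N ℝ) (e₂.symm y)
        (h.inner (e₂.symm y) (spaceVector e₂ i y) (spaceVector e₂ j y))) e₂.target y := by
    apply ContMDiffWithinAt.clm_bundle_apply₂ (F₁ := EuclideanSpace ℝ (Fin d))
      (F₂ := EuclideanSpace ℝ (Fin d))
    · exact ContMDiffAt.comp_contMDiffWithinAt y h.contMDiff.contMDiffAt (hs y hy)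
    · exact contMDiffOn_spaceVector he₂ i y hy
    · exact contMDiffOn_spaceVector he₂ j y hy
  rw [Bundle.contMDiffWithinAt_totalSpace] at h1
  exact h1.2.contDiffWithinAt

/-- A null vector c of the Gram matrix would give a non-zero w = ∑ c_i v_i with B(w, w) = 0. -/
theorem gram_det_ne_zero {ι W : Type*} [Fintype ι] [DecidableEq ι] [AddCommGroup W] [Module ℝ W]
    {B : W →ₗ[ℝ] W →ₗ[ℝ] ℝ} (hB : ∀ w, w ≠ 0 → 0 < B w w) {v : ι → W}
    (hv : LinearIndependent ℝ v) : (Matrix.of fun i j => B (v i) (v j)).det ≠ 0 := by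
  intro h0
  obtain ⟨c, hc, hc0⟩ := Matrix.exists_mulVec_eq_zero_iff.2 h0
  have hw : ∑ i, c i • v i ≠ 0 := fun h1 =>
    hc (funext fun i => Fintype.linearIndependent_iff.1 hv c h1 i)
  refine (hB _ hw).ne' ?_
  simp only [map_sum, map_smul, LinearMap.sum_apply, LinearMap.smul_apply, smul_eq_mul]
  simp only [Finset.mul_sum]
  rw [Finset.sum_comm]
  refine Finset.sum_eq_zero fun i _ => ?_
  have h1 := congrFun hc0 i
  simp only [Matrix.mulVec, dotProduct, Matrix.of_apply, Pi.zero_apply] at h1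
  rw [← mul_zero (c i), ← h1, Finset.mul_sum]
  exact Finset.sum_congr rfl fun j _ => by ring

theorem spaceMetric_det_ne_zero (he₂ : e₂ ∈ atlas (EuclideanSpace ℝ (Fin d)) N)
    {y : EuclideanSpace ℝ (Fin d)} (hy : y ∈ e₂.target) :
    (Matrix.of fun i j => spaceMetric h e₂ i j y).det ≠ 0 := by
  have : IsManifold 𝓘(ℝ, EuclideanSpace ℝ (Fin d)) 1 N :=
    IsManifold.of_le (n := ∞) (by simp)
  have hinj := (mdifferentiable_of_mem_atlas (I := 𝓘(ℝ, EuclideanSpace ℝ (Fin d)))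
    he₂).symm.mfderiv_injective (x := y) hy
  let D : EuclideanSpace ℝ (Fin d) →ₗ[ℝ] EuclideanSpace ℝ (Fin d) :=
    (mfderiv 𝓘(ℝ, EuclideanSpace ℝ (Fin d)) 𝓘(ℝ, EuclideanSpace ℝ (Fin d)) e₂.symm y).toLinearMap
  have hli : LinearIndependent ℝ (D ∘ EuclideanSpace.basisFun (Fin d) ℝ) :=
    LinearIndependent.map' (EuclideanSpace.basisFun (Fin d) ℝ).toBasis.linearIndependent D
      (LinearMap.ker_eq_bot.2 hinj)
  exact gram_det_ne_zero (W := EuclideanSpace ℝ (Fin d)) (B := (h.inner (e₂.symm y)).toBilinForm)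
    (h.pos (e₂.symm y)) hli

theorem inner_zero_left (q : N) (w : EuclideanSpace ℝ (Fin d)) :
    h.inner q (0 : EuclideanSpace ℝ (Fin d)) w = 0 :=
  DFunLike.congr_fun (map_zero (h.inner q)) w

theorem inner_zero_right (q : N) (w : EuclideanSpace ℝ (Fin d)) :
    h.inner q w (0 : EuclideanSpace ℝ (Fin d)) = 0 :=
  map_zero (h.inner q w)

/-- The bridge from the manifold to coordinates: the atlas of T × N consists of the products of
charts, so each tensor equation on the product becomes a statement about components of this kind. -/
theorem isWarped_productChart {a : ℝ → ℝ} (ha : ContDiffOn ℝ ∞ a T) (hpos : ∀ t ∈ T, 0 < a t)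
    (he₁ : e₁ ∈ atlas ℝ T) (he₂ : e₂ ∈ atlas (EuclideanSpace ℝ (Fin d)) N) :
    IsWarped (T : Set ℝ) e₂.target a (spaceMetric h e₂)
      (metricComp (model d) (stdBasis d) (warpedMetric T a h) (e₁.prod e₂)) where
  isOpen_time := T.isOpen
  isOpen_space := e₂.open_target
  smooth_scale := ha
  scale_ne_zero t ht := (hpos t ht).ne'
  smooth_metric := contDiffOn_spaceMetric h he₂
  symm y _ i j := h.symm _ _ _
  det_ne_zero y hy := spaceMetric_det_ne_zero h he₂ hy
  inl_inl t ht y hy u v := by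
    rw [metricComp, coordVector_inl he₁ he₂ ht hy]
    refine (warpedMetric_apply T a h _ _ _).trans ?_
    rw [inner_zero_left h]
    norm_num
  inl_inr t ht y hy u j := by
    rw [metricComp, coordVector_inl he₁ he₂ ht hy, coordVector_inr he₁ he₂ ht hy]
    refine (warpedMetric_apply T a h _ _ _).trans ?_
    rw [inner_zero_left h]
    norm_num
  inr_inl t ht y hy i v := by
    rw [metricComp, coordVector_inl he₁ he₂ ht hy, coordVector_inr he₁ he₂ ht hy]
    refine (warpedMetric_apply T a h _ _ _).trans ?_
    rw [inner_zero_right h]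
    norm_num
  inr_inr t ht y hy i j := by
    rw [metricComp, coordVector_inr he₁ he₂ ht hy, coordVector_inr he₁ he₂ ht hy]
    refine (warpedMetric_apply T a h _ _ _).trans ?_
    have : a (((e₁.prod e₂).extend (model d)).symm (t, y)).1 = a t :=
      congrArg a (timeChart_symm_apply he₁ ht)
    rw [this, zero_mul, sub_zero]
    rfl

end ProductChart

/-! ### The conditions on the space-time. -/

section RobertsonWalker

variable {d : ℕ} {N : Type*} [TopologicalSpace N] [ChartedSpace (EuclideanSpace ℝ (Fin d)) N]
  [IsManifold 𝓘(ℝ, EuclideanSpace ℝ (Fin d)) ∞ N] {T : TopologicalSpace.Opens ℝ}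
  {e₁ : OpenPartialHomeomorph T ℝ} {e₂ : OpenPartialHomeomorph N (EuclideanSpace ℝ (Fin d))}
  {a : ℝ → ℝ}

theorem contMDiff_time (φ : ℝ → ℝ) (hφ : ContDiffOn ℝ ∞ φ T) :
    ContMDiff (model d) 𝓘(ℝ, ℝ) ∞ (fun p : T × N => φ p.1) :=
  hφ.contMDiffOn.comp_contMDiff (contMDiff_subtype_val.comp contMDiff_fst) fun p => p.1.2

/-- The inverse of the chart at p is defined on all of T and has derivative 1, so its tangent map
carries the constant field 1 of ℝ to this section. -/
theorem contMDiff_timeVector_interval :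
    ContMDiff 𝓘(ℝ, ℝ) 𝓘(ℝ, ℝ).tangent ∞
      (fun t : T => (⟨t, (1 : ℝ)⟩ : TangentBundle 𝓘(ℝ, ℝ) T)) := by
  intro p
  have hm := chart_mem_atlas ℝ p
  have htgt : ∀ t : T, (t : ℝ) ∈ (chartAt ℝ p).target := fun t => by
    rw [timeChart_target hm]
    exact t.2
  have hs := contMDiffOn_symm_of_mem_maximalAtlas (I := 𝓘(ℝ, ℝ)) (n := ∞)
    (IsManifold.subset_maximalAtlas hm)
  have h1 := hs.contMDiffOn_tangentMapWithin (m := ∞) le_rfl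
    (chartAt ℝ p).open_target.uniqueMDiffOn
  have h2 : ContMDiff 𝓘(ℝ, ℝ) 𝓘(ℝ, ℝ).tangent ∞
      (fun t => (⟨t, (1 : ℝ)⟩ : TangentBundle 𝓘(ℝ, ℝ) ℝ)) := fun t =>
    contMDiffAt_vectorSpace_iff_contDiffAt.2 contDiffAt_const
  have h3 := h1.comp_contMDiff (h2.comp (contMDiff_subtype_val (U := T))) htgt
  refine (h3.congr fun t => ?_) p
  have h4 : tangentMapWithin 𝓘(ℝ, ℝ) 𝓘(ℝ, ℝ) (chartAt ℝ p).symm (chartAt ℝ p).target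
      (⟨(t : ℝ), (1 : ℝ)⟩ : TangentBundle 𝓘(ℝ, ℝ) ℝ)
      = (⟨(chartAt ℝ p).symm t, (1 : ℝ)⟩ : TangentBundle 𝓘(ℝ, ℝ) T) := by
    simp only [tangentMapWithin, mfderivWithin_of_isOpen (chartAt ℝ p).open_target (htgt t),
      (hasMFDerivAt_timeChart_symm hm t.2).mfderiv]
    rfl
  refine Eq.trans ?_ h4.symm
  exact congrArg (fun q : T => (⟨q, (1 : ℝ)⟩ : TangentBundle 𝓘(ℝ, ℝ) T))
    (Subtype.ext (timeChart_symm_apply hm t.2).symm)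

theorem contMDiff_timeVector :
    ContMDiff (model d) (model d).tangent ∞
      (fun p : T × N => (⟨p, timeVector T p⟩ : TangentBundle (model d) (T × N))) := by
  have h1 := (contMDiff_timeVector_interval (T := T)).comp
    (contMDiff_fst (I := 𝓘(ℝ, ℝ)) (J := 𝓘(ℝ, EuclideanSpace ℝ (Fin d))) (M := T) (N := N))
  have h2 := (Bundle.contMDiff_zeroSection (n := ∞) (IB := 𝓘(ℝ, EuclideanSpace ℝ (Fin d))) ℝ
    (F := EuclideanSpace ℝ (Fin d))
    (fun y : N => TangentSpace 𝓘(ℝ, EuclideanSpace ℝ (Fin d)) y)).comp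
    (contMDiff_snd (I := 𝓘(ℝ, ℝ)) (J := 𝓘(ℝ, EuclideanSpace ℝ (Fin d))) (M := T) (N := N))
  exact (contMDiff_equivTangentBundleProd_symm (n := ∞)).comp (h1.prodMk h2)

theorem contDiffOn_ricciFactor (ha : ContDiffOn ℝ ∞ a T) (c : ℝ) :
    ContDiffOn ℝ ∞ (ricciFactor c a) T := by
  have h1 := ha.deriv_of_isOpen T.isOpen (m := ∞) le_rfl
  have h2 := h1.deriv_of_isOpen T.isOpen (m := ∞) le_rfl
  exact (contDiffOn_const.mul (h1.pow 2)).add (ha.mul h2)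

theorem contDiffOn_timeEigenvalue (ha : ContDiffOn ℝ ∞ a T) (hpos : ∀ t ∈ T, 0 < a t) (c : ℝ) :
    ContDiffOn ℝ ∞ (timeEigenvalue c a) T := by
  have h1 := ha.deriv_of_isOpen T.isOpen (m := ∞) le_rfl
  have h2 := h1.deriv_of_isOpen T.isOpen (m := ∞) le_rfl
  exact (contDiffOn_const.mul h2).div ha fun t ht => (hpos t ht).ne'

/-- The one place where T has to be an interval: on a connected open set, zero derivative means
constant. -/
theorem exists_deriv_ne_zero (hT : (T : Set ℝ).OrdConnected) (ha : ContDiffOn ℝ ∞ a T)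
    (hne : ∃ s ∈ T, ∃ t ∈ T, a s ≠ a t) : ∃ t ∈ T, deriv a t ≠ 0 := by
  obtain ⟨s, hs, t, ht, hst⟩ := hne
  by_contra! hcon
  exact hst (T.isOpen.is_const_of_deriv_eq_zero hT.isPreconnected
    (ha.differentiableOn (by simp)) (fun x hx => hcon x hx) hs ht)

theorem vectorComp_timeVector_inl (he₁ : e₁ ∈ atlas ℝ T)
    (he₂ : e₂ ∈ atlas (EuclideanSpace ℝ (Fin d)) N) {t : ℝ} {y : EuclideanSpace ℝ (Fin d)}
    (hy : y ∈ e₂.target) (u : Unit) :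
    vectorComp (model d) (stdBasis d) (timeVector (N := N) T) (e₁.prod e₂) (.inl u) (t, y) = 1 :=
  vectorComp_inl he₁ he₂ hy _ u

variable (h : Bundle.ContMDiffRiemannianMetric 𝓘(ℝ, EuclideanSpace ℝ (Fin d)) ∞
      (EuclideanSpace ℝ (Fin d)) (fun y : N => TangentSpace 𝓘(ℝ, EuclideanSpace ℝ (Fin d)) y))

/-- The metric is non-negative on vectors without time component. -/
theorem time_component_ne_zero {p : T × N} {v : ℝ × EuclideanSpace ℝ (Fin d)}
    (hv : warpedMetric T a h p v v = -1) : v.1 ≠ 0 := by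
  intro h0
  rw [warpedMetric_apply, h0] at hv
  have h1 : 0 ≤ h.inner p.2 v.2 v.2 := by
    by_cases h2 : v.2 = 0
    · rw [h2, inner_zero_left h]
    · exact (h.pos p.2 v.2 h2).le
  nlinarith [mul_nonneg (sq_nonneg (a p.1)) h1]

theorem ricciEigenvector (ha : ContDiffOn ℝ ∞ a T) (hpos : ∀ t ∈ T, 0 < a t) :
    RicciEigenvector (model d) (stdBasis d) (warpedMetric T a h) (timeVector (N := N) T) := by
  rintro e he ⟨t, y⟩ hx k
  obtain ⟨e₁, he₁, e₂, he₂, rfl⟩ := he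
  obtain ⟨ht, hy⟩ := (mem_productChart_target he₁).1 hx
  exact (isWarped_productChart h ha hpos he₁ he₂).ricci_eigenvector
    (fun _ _ _ hy u => vectorComp_timeVector_inl he₁ he₂ hy u)
    (fun _ _ _ hy i => vectorComp_timeVector_inr he₁ he₂ hy i) ht hy k

theorem sinyukov_of_perfectFluid (hd : 3 ≤ d) (ha : ContDiffOn ℝ ∞ a T) (hpos : ∀ t ∈ T, 0 < a t)
    (hPF : RicciPerfectFluid (model d) (stdBasis d) (warpedMetric T a h))
    (hEE : EigenvalueEquation (model d) (stdBasis d) (warpedMetric T a h)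
      (timeVector (N := N) T)) :
    RicciSinyukov (model d) (stdBasis d) (warpedMetric T a h) := by
  obtain ⟨A, B, v, -, -, -, hv, hPF⟩ := hPF
  rintro e he ⟨t, y⟩ hx j k l
  have hEE := hEE e he (t, y) hx
  have hPF := hPF e he
  obtain ⟨e₁, he₁, e₂, he₂, rfl⟩ := he
  obtain ⟨ht, hy⟩ := (mem_productChart_target he₁).1 hx
  have W := isWarped_productChart h ha hpos he₁ he₂
  have hU := fun (t : ℝ) (_ : t ∈ (T : Set ℝ)) y hy u =>
    vectorComp_timeVector_inl (N := N) (t := t) (y := y) he₁ he₂ hy u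
  have hU' := fun (t : ℝ) (_ : t ∈ (T : Set ℝ)) y hy i =>
    vectorComp_timeVector_inr (N := N) (t := t) (y := y) he₁ he₂ hy i
  -- `stdBasis d` unfolds to `timeBasis` of this basis, so the coordinate lemmas apply
  -- definitionally.
  refine W.nablaRicci_of_einstein (b := (EuclideanSpace.basisFun (Fin d) ℝ).toBasis)
    (by simpa using hd) (fun z hz i j => ?_) ht hy ?_ j k l
  · refine W.ricci_of_perfectFluid (b := (EuclideanSpace.basisFun (Fin d) ℝ).toBasis) ht hz
      (w := fun k => lower (metricComp (model d) (stdBasis d) (warpedMetric T a h) (e₁.prod e₂))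
        (vectorComp (model d) (stdBasis d) v (e₁.prod e₂)) k (t, z)) ?_
      (fun k l => hPF (t, z) ((mem_productChart_target he₁).2 ⟨ht, hz⟩) k l) i j
    have h1 : lower (metricComp (model d) (stdBasis d) (warpedMetric T a h) (e₁.prod e₂))
        (vectorComp (model d) (stdBasis d) v (e₁.prod e₂)) (.inl ()) (t, z)
        = -vectorComp (model d) (stdBasis d) v (e₁.prod e₂) (.inl ()) (t, z) := by
      simp [lower, W.inl_inl t ht z hz, W.inl_inr t ht z hz]
    rw [h1, vectorComp_inl he₁ he₂ hz]
    exact neg_ne_zero.2 (time_component_ne_zero h (hv _))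
  · have h1 := W.dirDeriv_eigenvalue (b := (EuclideanSpace.basisFun (Fin d) ℝ).toBasis) hU hU' ht hy
    have h2 := IsWarped.dirDeriv_eq (b := (EuclideanSpace.basisFun (Fin d) ℝ).toBasis)
      (f := scalarCurv (stdBasis d)
        (metricComp (model d) (stdBasis d) (warpedMetric T a h) (e₁.prod e₂)))
      (hU t ht y hy ()) (hU' t ht y hy)
    have hcard : ((Fintype.card (Unit ⊕ Fin d) : ℕ) : ℝ) + 2 = Fintype.card (Fin d) + 3 := by
      simp
      ring
    rw [← h1, ← hcard]
    exact hEE.trans (congrArg (2 * ·) h2)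

theorem conformalKilling_of_ricciSinyukov (hd : 3 ≤ d) (ha : ContDiffOn ℝ ∞ a T)
    (hpos : ∀ t ∈ T, 0 < a t)
    (hS : RicciSinyukov (model d) (stdBasis d) (warpedMetric T a h)) :
    RicciConformalKilling (model d) (stdBasis d) (warpedMetric T a h) := by
  intro e he x hx j k l
  have hS := hS e he x hx
  obtain ⟨e₁, he₁, e₂, he₂, rfl⟩ := he
  have W := isWarped_productChart h ha hpos he₁ he₂
  have hx' : x ∈ (T : Set ℝ) ×ˢ e₂.target := (mem_productChart_target he₁).1 hx
  have hd' : (3 : ℝ) ≤ d := by exact_mod_cast hd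
  have hcard : ((Fintype.card (Unit ⊕ Fin d) : ℕ) : ℝ) = d + 1 := by simp [add_comm]
  exact conformalKilling_of_sinyukov (n := ((Fintype.card (Unit ⊕ Fin d) : ℕ) : ℝ))
    (N := fun j k l => nablaRicci (stdBasis d)
      (metricComp (model d) (stdBasis d) (warpedMetric T a h) (e₁.prod e₂)) j k l x)
    (by rw [hcard]; linarith) (by rw [hcard]; linarith) (W.symm_warped x hx') hS j k l

theorem eigenvalueEquation_of_conformalKilling (ha : ContDiffOn ℝ ∞ a T)
    (hpos : ∀ t ∈ T, 0 < a t)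
    (hCK : RicciConformalKilling (model d) (stdBasis d) (warpedMetric T a h)) :
    EigenvalueEquation (model d) (stdBasis d) (warpedMetric T a h) (timeVector (N := N) T) := by
  rintro e he ⟨t, y⟩ hx
  have hCK := hCK e he (t, y) hx
  obtain ⟨e₁, he₁, e₂, he₂, rfl⟩ := he
  obtain ⟨ht, hy⟩ := (mem_productChart_target he₁).1 hx
  have W := isWarped_productChart h ha hpos he₁ he₂
  have hU := fun (t : ℝ) (_ : t ∈ (T : Set ℝ)) y hy u =>
    vectorComp_timeVector_inl (N := N) (t := t) (y := y) he₁ he₂ hy u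
  have hU' := fun (t : ℝ) (_ : t ∈ (T : Set ℝ)) y hy i =>
    vectorComp_timeVector_inr (N := N) (t := t) (y := y) he₁ he₂ hy i
  have h1 := W.dirDeriv_eigenvalue (b := (EuclideanSpace.basisFun (Fin d) ℝ).toBasis) hU hU' ht hy
  have h2 := IsWarped.dirDeriv_eq (b := (EuclideanSpace.basisFun (Fin d) ℝ).toBasis)
    (f := scalarCurv (stdBasis d)
      (metricComp (model d) (stdBasis d) (warpedMetric T a h) (e₁.prod e₂)))
    (hU t ht y hy ()) (hU' t ht y hy)
  have hcard : ((Fintype.card (Unit ⊕ Fin d) : ℕ) : ℝ) = Fintype.card (Fin d) + 1 := by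
    simp [add_comm]
  have h3 := W.eigenvalue_equation_of_conformalKilling
    (b := (EuclideanSpace.basisFun (Fin d) ℝ).toBasis) ht hy hcard hCK
  have hcard' : ((Fintype.card (Unit ⊕ Fin d) : ℕ) : ℝ) + 2 = Fintype.card (Fin d) + 3 := by
    rw [hcard]
    ring
  rw [← h1, ← hcard'] at h3
  exact h3.trans (congrArg (2 * ·) h2.symm)

theorem perfectFluid_of_conformalKilling (hT : (T : Set ℝ).OrdConnected)
    (ha : ContDiffOn ℝ ∞ a T) (hpos : ∀ t ∈ T, 0 < a t)
    (hne : ∃ s ∈ T, ∃ t ∈ T, a s ≠ a t)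
    (hCK : RicciConformalKilling (model d) (stdBasis d) (warpedMetric T a h)) :
    RicciPerfectFluid (model d) (stdBasis d) (warpedMetric T a h) := by
  obtain ⟨t₀, ht₀, hat₀⟩ := exists_deriv_ne_zero hT ha hne
  -- The Einstein constant of the fibre is evaluated at t₀ only, so A is globally a function of time
  -- and its smoothness needs nothing from the fibre.
  let A : ℝ → ℝ := fun t =>
    (fibreFactor (Fintype.card (Fin d)) a t₀ + ricciFactor (Fintype.card (Fin d)) a t) / a t ^ 2
  have hA : ContDiffOn ℝ ∞ A T := (contDiffOn_const.add (contDiffOn_ricciFactor ha _)).div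
    (ha.pow 2) fun t ht => pow_ne_zero 2 (hpos t ht).ne'
  refine ⟨fun p => A p.1, fun p => A p.1 - timeEigenvalue (Fintype.card (Fin d)) a p.1,
    timeVector T, contMDiff_time A hA,
    contMDiff_time (fun t => A t - timeEigenvalue (Fintype.card (Fin d)) a t)
      (hA.sub (contDiffOn_timeEigenvalue ha hpos _)), contMDiff_timeVector, fun p => ?_, ?_⟩
  · refine (warpedMetric_apply T a h p (1, 0) (1, 0)).trans ?_
    rw [inner_zero_left h]
    norm_num
  rintro e he ⟨t, y⟩ hx k l
  have hcard : ((Fintype.card (Unit ⊕ Fin d) : ℕ) : ℝ) = Fintype.card (Fin d) + 1 := by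
    simp [add_comm]
  have hCK := hCK e he
  obtain ⟨e₁, he₁, e₂, he₂, rfl⟩ := he
  obtain ⟨ht, hy⟩ := (mem_productChart_target he₁).1 hx
  have W := isWarped_productChart h ha hpos he₁ he₂
  -- The image of a product chart is all of T times the image of `e₂`, so (t₀, y) lies in the same
  -- chart as (t, y), and (CK) there determines the Ricci tensor of the fibre at y.
  have h1 := W.ricci_of_conformalKilling (b := (EuclideanSpace.basisFun (Fin d) ℝ).toBasis) ht₀ hy
    hat₀ hcard (hCK (t₀, y) ((mem_productChart_target he₁).2 ⟨ht₀, hy⟩))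
  have h2 := W.ricci_eq_perfectFluid (b := (EuclideanSpace.basisFun (Fin d) ℝ).toBasis) ht hy h1
    (U := vectorComp (model d) (stdBasis d) (timeVector (N := N) T) (e₁.prod e₂))
    (vectorComp_timeVector_inl he₁ he₂ hy ()) (vectorComp_timeVector_inr he₁ he₂ hy) k l
  have h3 : ((((e₁.prod e₂).extend (model d)).symm (t, y)).1 : ℝ) = t :=
    timeChart_symm_apply he₁ ht
  simp only [h3]
  exact h2

end RobertsonWalker

end GRW

end

/-! ### Assembly of the implications. -/

open GRW in
theorem mainTheorem5
    {d : ℕ} (hd : 3 ≤ d)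
    {N : Type*} [TopologicalSpace N] [ChartedSpace (EuclideanSpace ℝ (Fin d)) N]
    [IsManifold 𝓘(ℝ, EuclideanSpace ℝ (Fin d)) ∞ N]
    (h : Bundle.ContMDiffRiemannianMetric 𝓘(ℝ, EuclideanSpace ℝ (Fin d)) ∞
      (EuclideanSpace ℝ (Fin d))
      (fun y : N => TangentSpace 𝓘(ℝ, EuclideanSpace ℝ (Fin d)) y))
    (T : TopologicalSpace.Opens ℝ) (hT : (T : Set ℝ).OrdConnected)
    (a : ℝ → ℝ) (ha : ContDiffOn ℝ ∞ a T) (hpos : ∀ t ∈ T, 0 < a t) :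
    RicciEigenvector (model d) (stdBasis d) (warpedMetric T a h) (timeVector (N := N) T) ∧
    (RicciPerfectFluid (model d) (stdBasis d) (warpedMetric T a h) ∧
        EigenvalueEquation (model d) (stdBasis d) (warpedMetric T a h) (timeVector (N := N) T) →
      RicciSinyukov (model d) (stdBasis d) (warpedMetric T a h) ∧
      RicciConformalKilling (model d) (stdBasis d) (warpedMetric T a h)) ∧
    ((∃ s ∈ T, ∃ t ∈ T, a s ≠ a t) →
      (RicciConformalKilling (model d) (stdBasis d) (warpedMetric T a h) ↔
        RicciPerfectFluid (model d) (stdBasis d) (warpedMetric T a h) ∧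
        EigenvalueEquation (model d) (stdBasis d) (warpedMetric T a h) (timeVector (N := N) T)) ∧
      (RicciConformalKilling (model d) (stdBasis d) (warpedMetric T a h) ↔
        RicciSinyukov (model d) (stdBasis d) (warpedMetric T a h))) := by
  have hSK := conformalKilling_of_ricciSinyukov h hd ha hpos
  have hPS : RicciPerfectFluid (model d) (stdBasis d) (warpedMetric T a h) ∧
      EigenvalueEquation (model d) (stdBasis d) (warpedMetric T a h) (timeVector (N := N) T) →
      RicciSinyukov (model d) (stdBasis d) (warpedMetric T a h) :=
    fun hP => sinyukov_of_perfectFluid h hd ha hpos hP.1 hP.2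
  refine ⟨ricciEigenvector h ha hpos, fun hP => ⟨hPS hP, hSK (hPS hP)⟩, fun hne => ?_⟩
  have hKP := fun hCK : RicciConformalKilling (model d) (stdBasis d) (warpedMetric T a h) =>
    And.intro (perfectFluid_of_conformalKilling h hT ha hpos hne hCK)
      (eigenvalueEquation_of_conformalKilling h ha hpos hCK)
  exact ⟨⟨hKP, fun hP => hSK (hPS hP)⟩, ⟨fun hCK => hPS (hKP hCK), hSK⟩⟩
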